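/- Let $f$ be an entire function of order $\rho=\limsup_{r\to\infty}\frac{\log\log M_f(r)}{\log r}$, $M_f(r)=\max_{|z|=r}|f(z)|$, with $0<\rho<\tfrac12$. Let $\mathrm{Aut}(f)=\{\phi_{0n}\}_n$ be the (in general multivalued) automorphic functions of $f$, i.e. the analytic solutions $\phi$ of $f(\phi(w))=f(w)$; for fixed $w$ the values $\phi_{0n}(w)$ are the zeros of $v\mapsto f(v)-f(w)$, counted with multiplicity. For $R>0$ put $$S_R(w)=\sum_{|\phi_{0n}(w)|<R}\phi_{0n}(w).$$ Then there is a sequence $0<R_1<R_2<\cdots$, $R_j\to\infty$, such that for every integer $k\ge 1$ and every $w\in\mathbb{C}$: 1. if all the branches $\phi_{0n}$ are holomorphic at $w$ (that is, for every $u$ with $f(u)=f(w)$ the number of germs $\phi$ of holomorphic functions at $w$ with $f\circ\phi=f$ and $\phi(w)=u$ equals the multiplicity of $u$ as a zero of $f-f(w)$), then $$\lim_{j\to\infty}\ \sum_{|\phi_{0n}(w)|<R_j}\phi_{0n}^{(k)}(w)=0;$$ 2. without any restriction on $w$, the function $S_{R_j}$ is holomorphic at $w$ for all large $j$, and $$\lim_{j\to\infty}\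 \frac{d^k}{dw^k}S_{R_j}(w)=0;$$ 3. for all large $j$ there is a punctured neighbourhood of $w$ at every point $z$ of which all the branches $\phi_{0n}$ with $|\phi_{0n}(z)|<R_j$ are holomorphic and $\sum_{|\phi_{0n}(z)|<R_j}\phi_{0n}^{(k)}(z)=\frac{d^k}{dz^k}S_{R_j}(z)$. Thus $S_{R_j}^{(k)}$ is, near $w$, the continuous extension of the sum of the derivatives, and in this sense $\lim_{j\to\infty}\sum_{|\phi_{0n}(w)|<R_j}\phi_{0n}^{(k)}(w)=0$ holds for every $w\in\mathbb{C}$. -/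

import Mathlib

open Filter Topology

noncomputable section

/-- The maximum modulus `M_f(r) = max_{|z| = r} |f z|`. -/
def maxModulus (f : ℂ → ℂ) (r : ℝ) : ℝ :=
  sSup ((fun z => ‖f z‖) '' Metric.sphere (0 : ℂ) r)

/-- The order of growth `limsup_{r → ∞} log log M_f(r) / log r` of an entire function, with values
in the extended reals. -/
def growthOrder (f : ℂ → ℂ) : EReal :=
  limsup (fun r : ℝ => ((Real.log (Real.log (maxModulus f r)) / Real.log r : ℝ) : EReal)) atTop

/-- The holomorphic branches at `w` of the automorphic functions of `f`: all germs at `w` of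
holomorphic functions `g` that satisfy the automorphic equation `f (g z) = f z`. -/
def autBranches (f : ℂ → ℂ) (w : ℂ) : Set (Germ (𝓝 w) ℂ) :=
  {φ | ∃ g : ℂ → ℂ, AnalyticAt ℂ g w ∧ (∀ᶠ z in 𝓝 w, f (g z) = f z) ∧ φ = (g : Germ (𝓝 w) ℂ)}

/-- The `k`-th derivative at `w` of a germ at `w`. -/
def germDeriv (k : ℕ) {w : ℂ} (φ : Germ (𝓝 w) ℂ) : ℂ :=
  φ.liftOn (fun g => iteratedDeriv k g w) (fun _ _ h => h.iteratedDeriv_eq k)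

/-- The multiplicity of `u` as a zero of the function `v ↦ f v - f w`. -/
def fibreMult (f : ℂ → ℂ) (w u : ℂ) : ℕ∞ :=
  analyticOrderAt (fun v => f v - f w) u

/-- Let `f u = f w`. All the branches at `w` of the automorphic functions that take the value `u`
at `w` are holomorphic (unbranched) at `w`: there are as many holomorphic branches with this value
as the multiplicity of `u` in the orbit of `w` requires. -/
def IsUnbranchedAt (f : ℂ → ℂ) (w u : ℂ) : Prop :=
  {φ ∈ autBranches f w | φ.value = u}.encard = fibreMult f w u

/-- The sum `∑_{|φ w| < R} φ^{(k)} w` over the branches `φ` at `w` of the automorphic functions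
of `f`. -/
def autDerivSum (f : ℂ → ℂ) (k : ℕ) (R : ℝ) (w : ℂ) : ℂ :=
  ∑ᶠ φ ∈ {φ ∈ autBranches f w | ‖φ.value‖ < R}, germDeriv k φ

/-- The sum `∑_{|φ w| < R} φ w` over the orbit of `w` under the automorphic functions of `f`, that
is, over the zeros `u` of `v ↦ f v - f w` with `|u| < R`, counted with multiplicity. -/
def autSum (f : ℂ → ℂ) (R : ℝ) (w : ℂ) : ℂ :=
  ∑ᶠ u ∈ {u : ℂ | f u = f w ∧ ‖u‖ < R}, ((fibreMult f w u).toNat : ℂ) * u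

end

/-! ### Zeros of entire functions -/

/-! The orbit sum depends on `w` only through `c = f w`. When `f - c` has no zero on `|v| = R`, the
argument principle writes it as `Φ_R(c) = (2πi)⁻¹ ∮ v f'(v) / (f(v) - c) dv`. If `|c| < |f|` on the
circle, integration by parts gives `Φ_R(c) - Φ_R(0) = -(2πi)⁻¹ ∮ log(1 - c / f(v)) dv`
(`fibreSum_sub_fibreSum_zero`), which is `O(R |c| / min |f|)`. Along radii with `min |f| / R_j → ∞`
this difference tends to zero locally uniformly in `w`, and Cauchy's estimates carry the decay over
to every derivative of order `k ≥ 1`. Branch points play no role, since `Φ_R ∘ f` is holomorphic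
there too.

Such radii come from `exists_circle_large_minimum`. Suppose that `min |f| ≤ K r` on every large
circle, with `f 0 = 1` after a shift. By Hadamard, `f` is the product of `1 - z/u` over its zeros.
Let `F` be the product with each zero `u` moved to `|u|`. Then `|F(r)| ≤ |f| ≤ |F(-r)|` on `|z| =
r`, so `F` grows at most linearly on the positive axis. As `F` has growth exponent below `1/2`,
Phragmén–Lindelöf makes it affine (`affine_of_growth_of_bound`). Hence `f` grows at most linearly,
against `ρ > 0`.

Where all branches in the disc are holomorphic, a count of solutions, which is independent of `c`,
shows that they exhaust the nearby fibres, so that the orbit sum is the sum of the branches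
(`exists_eventually_autSum_eq_sum`). -/

lemma analyticOrderAt_ne_top_of_entire {f : ℂ → ℂ} (hf : Differentiable ℂ f) {a : ℂ} (ha : f a ≠ 0)
    (u : ℂ) : analyticOrderAt f u ≠ ⊤ := by
  intro h
  rw [AnalyticOnNhd.analyticOrderAt_eq_top_iff_eq_zero u (fun z => hf.analyticAt z)] at h
  exact ha (by simp [h])

lemma finite_zeros_closedBall {f : ℂ → ℂ} (hf : Differentiable ℂ f) {a : ℂ} (ha : f a ≠ 0) (R : ℝ) :
    {z : ℂ | f z = 0 ∧ ‖z‖ ≤ R}.Finite := by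
  by_contra hinf
  obtain ⟨x, -, hx⟩ := Set.Infinite.exists_accPt_of_subset_isCompact hinf
    (isCompact_closedBall (0 : ℂ) R) (fun z hz => by simpa using hz.2)
  have hfr : ∃ᶠ z in 𝓝[≠] x, f z = 0 :=
    (accPt_iff_frequently_nhdsNE.1 hx).mono fun z hz => hz.1
  have h1 := ((hf.analyticAt x).frequently_zero_iff_eventually_zero).1 hfr
  exact analyticOrderAt_ne_top_of_entire hf ha x (analyticOrderAt_eq_top.2 h1)

lemma exists_entire_eq_pow_mul {f : ℂ → ℂ} (hf : Differentiable ℂ f) {a : ℂ} (ha : f a ≠ 0) (u : ℂ) :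
    ∃ g : ℂ → ℂ, Differentiable ℂ g ∧ (∀ z, f z = (z - u) ^ analyticOrderNatAt f u * g z) ∧
      g u ≠ 0 := by
  obtain ⟨q, hq, hqu, hfq⟩ :=
    (hf.analyticAt u).analyticOrderAt_ne_top.1 (analyticOrderAt_ne_top_of_entire hf ha u)
  set n := analyticOrderNatAt f u
  classical
  refine ⟨Function.update (fun z => f z / (z - u) ^ n) u (q u), ?_, ?_, by simpa using hqu⟩
  · intro z
    rcases eq_or_ne z u with rfl | hz
    · refine (hq.differentiableAt).congr_of_eventuallyEq ?_
      filter_upwards [hfq] with v hv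
      rcases eq_or_ne v z with rfl | hvz
      · simp
      · have : (v - z) ^ n ≠ 0 := pow_ne_zero _ (sub_ne_zero.2 hvz)
        rw [Function.update_of_ne hvz, hv, smul_eq_mul, mul_div_cancel_left₀ _ this]
    · have h1 : DifferentiableAt ℂ (fun z => f z / (z - u) ^ n) z :=
        (hf z).div (by fun_prop) (pow_ne_zero _ (sub_ne_zero.2 hz))
      refine h1.congr_of_eventuallyEq ?_
      filter_upwards [isOpen_ne.mem_nhds hz] with v hv
      rw [Function.update_of_ne hv]
  · intro z
    rcases eq_or_ne z u with rfl | hz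
    · simpa using hfq.self_of_nhds
    · have : (z - u) ^ n ≠ 0 := pow_ne_zero _ (sub_ne_zero.2 hz)
      rw [Function.update_of_ne hz, mul_div_cancel₀ _ this]

/-- Splitting off finitely many zeros of an entire function. -/
lemma exists_entire_eq_prod_pow_mul {f : ℂ → ℂ} (hf : Differentiable ℂ f) {a : ℂ} (ha : f a ≠ 0)
    (Z : Finset ℂ) :
    ∃ g : ℂ → ℂ, Differentiable ℂ g ∧
      (∀ z, f z = (∏ u ∈ Z, (z - u) ^ analyticOrderNatAt f u) * g z) ∧ ∀ u ∈ Z, g u ≠ 0 := by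
  classical
  induction Z using Finset.induction_on with
  | empty => exact ⟨f, hf, by simp, by simp⟩
  | insert b Z hb ih =>
    obtain ⟨g, hg, hfg, hgZ⟩ := ih
    have hga : g a ≠ 0 := fun h => ha (by rw [hfg, h, mul_zero])
    obtain ⟨q, hq, hgq, hqb⟩ := exists_entire_eq_pow_mul hg hga b
    set P : ℂ → ℂ := fun z => ∏ u ∈ Z, (z - u) ^ analyticOrderNatAt f u with hP
    have hPd : Differentiable ℂ P := by
      rw [hP]; fun_prop
    have hPb : P b ≠ 0 := by
      rw [hP]
      refine Finset.prod_ne_zero_iff.2 fun u hu => pow_ne_zero _ (sub_ne_zero.2 ?_)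
      rintro rfl; exact hb hu
    have hord : analyticOrderNatAt f b = analyticOrderNatAt g b := by
      have : f = P * g := funext hfg
      have h2 : analyticOrderAt f b = analyticOrderAt g b := by
        rw [this, analyticOrderAt_mul (hPd.analyticAt b) (hg.analyticAt b),
          (hPd.analyticAt b).analyticOrderAt_eq_zero.2 hPb, zero_add]
      simp [analyticOrderNatAt, h2]
    refine ⟨q, hq, fun z => ?_, fun u hu => ?_⟩
    · rw [Finset.prod_insert hb, hfg z, hgq z, hord]; ring
    · rcases Finset.mem_insert.1 hu with rfl | hu
      · exact hqb
      · intro h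
        exact hgZ u hu (by rw [hgq, h, mul_zero])

/-- A holomorphic logarithm on a disc. -/
lemma exists_log_of_ne_zero {g : ℂ → ℂ} (hg : Differentiable ℂ g) {R : ℝ} (hR : 0 < R)
    (hne : ∀ z ∈ Metric.ball (0 : ℂ) R, g z ≠ 0) (h0 : g 0 = 1) :
    ∃ h : ℂ → ℂ, DifferentiableOn ℂ h (Metric.ball 0 R) ∧ h 0 = 0 ∧
      ∀ z ∈ Metric.ball (0 : ℂ) R, Complex.exp (h z) = g z := by
  have hd : DifferentiableOn ℂ (fun z => deriv g z / g z) (Metric.ball 0 R) :=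
    (hg.analyticAt · |>.deriv.differentiableAt.differentiableWithinAt) |> fun H =>
      DifferentiableOn.div (fun z _ => H z) hg.differentiableOn hne
  obtain ⟨h, hh0, hh⟩ := hd.isExactOn_ball.with_val_at 0 0
  have hhd : DifferentiableOn ℂ h (Metric.ball 0 R) :=
    fun z hz => (hh z hz).differentiableAt.differentiableWithinAt
  refine ⟨h, hhd, hh0, fun z hz => ?_⟩
  have key : ∀ z ∈ Metric.ball (0 : ℂ) R, HasDerivAt (fun z => g z * Complex.exp (-h z)) 0 z := by
    intro z hz
    refine ((hg z).hasDerivAt.fun_mul (hh z hz).fun_neg.cexp).congr_deriv ?_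
    have := hne z hz
    field_simp
    ring
  have hc := Metric.isOpen_ball.is_const_of_deriv_eq_zero (convex_ball (0 : ℂ) R).isPreconnected
    (fun z hz => (key z hz).differentiableAt.differentiableWithinAt)
    (fun z hz => (key z hz).deriv) hz (Metric.mem_ball_self hR)
  simp only [h0, hh0, neg_zero, Complex.exp_zero, mul_one] at hc
  rw [Complex.exp_neg] at hc
  field_simp at hc
  exact hc.symm

/-! ### Counting zeros and Hadamard factorisation -/

/-- The zeros of an entire function `f ≢ 0` in a closed disc about the origin. -/
noncomputable def zerosIn {f : ℂ → ℂ} (hf : Differentiable ℂ f) {a : ℂ} (ha : f a ≠ 0) (R : ℝ) :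
    Finset ℂ :=
  (finite_zeros_closedBall hf ha R).toFinset

lemma mem_zerosIn {f : ℂ → ℂ} (hf : Differentiable ℂ f) {a : ℂ} (ha : f a ≠ 0) {R : ℝ} {z : ℂ} :
    z ∈ zerosIn hf ha R ↔ f z = 0 ∧ ‖z‖ ≤ R := by
  simp [zerosIn]

lemma norm_le_of_sphere {g : ℂ → ℂ} (hg : Differentiable ℂ g) {R C : ℝ} (hR : R ≠ 0)
    (h : ∀ z, ‖z‖ = R → ‖g z‖ ≤ C) {z : ℂ} (hz : ‖z‖ ≤ R) : ‖g z‖ ≤ C := by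
  refine Complex.norm_le_of_forall_mem_frontier_norm_le (U := Metric.ball (0 : ℂ) R)
    Metric.isBounded_ball hg.diffContOnCl (fun w hw => h w ?_) ?_
  · rw [frontier_ball _ hR] at hw; simpa using hw
  · rw [closure_ball _ hR]; simpa using hz

/-- The number of zeros in a disc is bounded by the growth, and the cofactor of the polynomial
formed by these zeros is close to one. -/
lemma exists_cofactor_near_one {f : ℂ → ℂ} (hf : Differentiable ℂ f) (h0 : f 0 = 1) {a : ℂ}
    (ha : f a ≠ 0) {S M : ℝ} (hS : 0 < S) (hM : 0 < M)
    (hG : ∀ z, ‖z‖ = 4 * S → ‖f z‖ ≤ Real.exp M) :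
    (∑ u ∈ zerosIn hf ha S, (analyticOrderNatAt f u : ℝ)) ≤ M ∧
    ∀ z, ‖z‖ < S → ∃ ζ : ℂ,
      f z = (∏ u ∈ zerosIn hf ha S, (1 - z / u) ^ analyticOrderNatAt f u) * Complex.exp ζ ∧
      ‖ζ‖ ≤ 2 * M * ‖z‖ / (S - ‖z‖) := by
  set Z := zerosIn hf ha S with hZ
  obtain ⟨g, hg, hfg, hgZ⟩ := exists_entire_eq_prod_pow_mul hf ha Z
  set m := analyticOrderNatAt f
  have hZ0 : ∀ u ∈ Z, u ≠ 0 := by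
    rintro u hu rfl
    rw [hZ, mem_zerosIn, h0] at hu
    exact one_ne_zero hu.1
  -- Moving the constant `P0` into the cofactor turns the factors `z - u` into `1 - z/u` and gives
  -- `g1 0 = 1`.
  set P0 : ℂ := ∏ u ∈ Z, (-u) ^ m u with hP0
  have hP0' : P0 ≠ 0 := Finset.prod_ne_zero_iff.2 fun u hu => pow_ne_zero _ (neg_ne_zero.2 (hZ0 u hu))
  set g1 : ℂ → ℂ := fun z => P0 * g z with hg1
  have hg1d : Differentiable ℂ g1 := hg.const_mul P0
  have hfac : ∀ z, f z = (∏ u ∈ Z, (1 - z / u) ^ m u) * g1 z := by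
    intro z
    rw [hfg z, hg1]
    simp only [← mul_assoc, hP0, ← Finset.prod_mul_distrib]
    congr 1
    refine Finset.prod_congr rfl fun u hu => ?_
    have := hZ0 u hu
    rw [← mul_pow]
    congr 1
    field_simp
    ring
  have hg10 : g1 0 = 1 := by simpa [h0] using (hfac 0).symm
  set n : ℝ := ∑ u ∈ Z, (m u : ℝ) with hn
  have hsph : ∀ z, ‖z‖ = 4 * S → ‖g1 z‖ ≤ Real.exp (M - n) := by
    intro z hz
    -- The radius `4 * S` is chosen for this: `|u| ≤ S` gives `|1 - z/u| ≥ 4 - 1 = 3 > e`, so each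
    -- zero contributes a factor `e`.
    have hQ : Real.exp n ≤ ‖∏ u ∈ Z, (1 - z / u) ^ m u‖ := by
      rw [hn, Real.exp_sum, norm_prod]
      refine Finset.prod_le_prod (fun _ _ => (Real.exp_pos _).le) fun u hu => ?_
      rw [norm_pow, ← mul_one (m u : ℝ), Real.exp_nat_mul]
      refine pow_le_pow_left₀ (Real.exp_pos _).le ?_ _
      have hu1 : ‖u‖ ≤ S := ((mem_zerosIn hf ha).1 hu).2
      have hu0 : 0 < ‖u‖ := norm_pos_iff.2 (hZ0 u hu)
      have h4 : (4 : ℝ) ≤ ‖z / u‖ := by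
        rw [norm_div, hz, le_div_iff₀ hu0]; linarith
      have h5 : ‖z / u‖ ≤ ‖1 - z / u‖ + 1 := by
        have := norm_sub_le (1 : ℂ) (1 - z / u)
        simp only [sub_sub_cancel, norm_one] at this
        linarith
      linarith [Real.exp_one_lt_three]
    have hQpos := (Real.exp_pos n).trans_le hQ
    have h1 := hG z hz
    rw [hfac z, norm_mul] at h1
    rw [Real.exp_sub, le_div_iff₀ (Real.exp_pos _)]
    calc ‖g1 z‖ * Real.exp n ≤ ‖g1 z‖ * _ := mul_le_mul_of_nonneg_left hQ (norm_nonneg _)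
      _ ≤ _ := by rw [mul_comm]; exact h1
  have hball : ∀ z, ‖z‖ ≤ 4 * S → ‖g1 z‖ ≤ Real.exp (M - n) := fun z hz =>
    norm_le_of_sphere hg1d (by positivity) hsph hz
  have hn0 : 0 ≤ n := Finset.sum_nonneg fun _ _ => Nat.cast_nonneg _
  -- Jensen's bound: the maximum principle at `0` gives `1 = |g1 0| ≤ exp (M - n)`.
  have hnM : n ≤ M := by
    have := hball 0 (by simp; positivity)
    rw [hg10, norm_one, Real.one_le_exp_iff] at this
    linarith
  refine ⟨hnM, fun z hz => ?_⟩
  have hne : ∀ z ∈ Metric.ball (0 : ℂ) S, g1 z ≠ 0 := by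
    intro w hw hw0
    have hwS : ‖w‖ ≤ S := by simpa using (Metric.ball_subset_closedBall hw)
    have hgw : g w = 0 := by simpa [hg1, hP0'] using hw0
    have hfw : f w = 0 := by rw [hfg, hgw, mul_zero]
    exact hgZ w ((mem_zerosIn hf ha).2 ⟨hfw, hwS⟩) hgw
  obtain ⟨h, hhd, hh0, hh⟩ := exists_log_of_ne_zero hg1d hS hne hg10
  have hzb : z ∈ Metric.ball (0 : ℂ) S := by simpa using hz
  refine ⟨h z, by rw [hh z hzb]; exact hfac z, ?_⟩
  refine Complex.borelCaratheodory_zero hM hhd (fun w hw => ?_) hS hzb hh0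
  have hwS : ‖w‖ ≤ 4 * S := by
    have : ‖w‖ < S := by simpa using hw
    linarith
  have h1 := hball w hwS
  rw [← hh w hw, Complex.norm_exp, Real.exp_le_exp] at h1
  simp only [Set.mem_ofPred_eq]
  linarith

/-- The zeros of `f`, repeated according to their multiplicity. -/
abbrev ZeroIndex (f : ℂ → ℂ) : Type := Σ u : {u : ℂ // f u = 0}, Fin (analyticOrderNatAt f u)

/-- The indices of the zeros in a closed disc about the origin. -/
noncomputable def zeroIndexIn {f : ℂ → ℂ} (hf : Differentiable ℂ f) {a : ℂ} (ha : f a ≠ 0) (R : ℝ) :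
    Finset (ZeroIndex f) := by
  classical exact ((zerosIn hf ha R).subtype (fun u => f u = 0)).sigma fun _ => Finset.univ

lemma mem_zeroIndexIn {f : ℂ → ℂ} (hf : Differentiable ℂ f) {a : ℂ} (ha : f a ≠ 0) {R : ℝ}
    {i : ZeroIndex f} : i ∈ zeroIndexIn hf ha R ↔ ‖(i.1 : ℂ)‖ ≤ R := by
  simp [zeroIndexIn, mem_zerosIn, i.1.2]

lemma prod_zeroIndexIn {f : ℂ → ℂ} (hf : Differentiable ℂ f) {a : ℂ} (ha : f a ≠ 0) (R : ℝ)
    {β : Type*} [CommMonoid β] (φ : ℂ → β) :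
    ∏ i ∈ zeroIndexIn hf ha R, φ i.1 = ∏ u ∈ zerosIn hf ha R, φ u ^ analyticOrderNatAt f u := by
  classical
  simp only [zeroIndexIn, Finset.prod_sigma, Finset.prod_const, Finset.card_univ, Fintype.card_fin]
  rw [Finset.prod_subtype_of_mem (fun u => φ u ^ analyticOrderNatAt f u)]
  exact fun u hu => ((mem_zerosIn hf ha).1 hu).1

lemma sum_zeroIndexIn {f : ℂ → ℂ} (hf : Differentiable ℂ f) {a : ℂ} (ha : f a ≠ 0) (R : ℝ)
    (φ : ℂ → ℝ) :
    ∑ i ∈ zeroIndexIn hf ha R, φ i.1 = ∑ u ∈ zerosIn hf ha R, analyticOrderNatAt f u * φ u := by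
  classical
  simp only [zeroIndexIn, Finset.sum_sigma, Finset.sum_const, Finset.card_univ, Fintype.card_fin,
    nsmul_eq_mul]
  rw [Finset.sum_subtype_of_mem (fun u => (analyticOrderNatAt f u : ℝ) * φ u)]
  exact fun u hu => ((mem_zerosIn hf ha).1 hu).1

/-- Discs exhaust the index set, so sums and products over all finite subsets of `ZeroIndex f` can
be evaluated along discs. -/
lemma tendsto_zeroIndexIn {f : ℂ → ℂ} (hf : Differentiable ℂ f) {a : ℂ} (ha : f a ≠ 0) :
    Tendsto (fun R : ℝ => zeroIndexIn hf ha R) atTop atTop := by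
  refine tendsto_atTop_finset_of_monotone (fun R R' h i hi => ?_) fun i =>
    ⟨‖(i.1 : ℂ)‖, (mem_zeroIndexIn hf ha).2 le_rfl⟩
  rw [mem_zeroIndexIn] at hi ⊢
  exact hi.trans h

/-- The exponent of convergence of the zeros is at most the order. -/
lemma summable_zeros_rpow_neg {f : ℂ → ℂ} (hf : Differentiable ℂ f) (h0 : f 0 = 1) {A σ τ : ℝ}
    (hA : 0 < A) (hσ : 0 < σ) (hτ : σ < τ)
    (hG : ∀ R : ℝ, 1 ≤ R → ∀ z, ‖z‖ ≤ R → ‖f z‖ ≤ Real.exp (A * R ^ σ)) :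
    Summable fun i : ZeroIndex f => ‖(i.1 : ℂ)‖ ^ (-τ) := by
  have ha : f 0 ≠ 0 := by simp [h0]
  set m := analyticOrderNatAt f with hm
  have hcount : ∀ S : ℝ, 1 ≤ S → (∑ u ∈ zerosIn hf ha S, (m u : ℝ)) ≤ A * (4 * S) ^ σ := by
    intro S hS
    have hM : 0 < A * (4 * S) ^ σ := by positivity
    exact (exists_cofactor_near_one hf h0 ha (by linarith) hM
      fun z hz => hG (4 * S) (by linarith) z hz.le).1
  set q : ℝ := 2 ^ (σ - τ) with hq
  have hq0 : 0 < q := by positivity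
  have hq1 : q < 1 := Real.rpow_lt_one_of_one_lt_of_neg (by norm_num) (by linarith)
  set T : ℕ → ℝ := fun N => ∑ u ∈ zerosIn hf ha (2 ^ N), m u * ‖u‖ ^ (-τ) with hT
  -- In the annulus `2^N ≤ |u| ≤ 2^(N+1)` there are at most `A (4 · 2^(N+1))^σ = A 8^σ 2^(Nσ)`
  -- zeros, each weighing at most `2^(-Nτ)`. The resulting series is geometric because `σ < τ`.
  have hstep : ∀ N, T (N + 1) ≤ T N + A * 8 ^ σ * q ^ N := by
    intro N
    classical
    have hsub : zerosIn hf ha (2 ^ N) ⊆ zerosIn hf ha (2 ^ (N + 1)) := by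
      intro u hu
      rw [mem_zerosIn] at hu ⊢
      exact ⟨hu.1, hu.2.trans (pow_le_pow_right₀ (by norm_num) (by omega))⟩
    rw [hT]
    simp only
    rw [← Finset.sum_sdiff hsub, add_comm]
    refine add_le_add_right ?_ _
    calc ∑ u ∈ zerosIn hf ha (2 ^ (N + 1)) \ zerosIn hf ha (2 ^ N), (m u : ℝ) * ‖u‖ ^ (-τ)
        ≤ ∑ u ∈ zerosIn hf ha (2 ^ (N + 1)) \ zerosIn hf ha (2 ^ N),
            (m u : ℝ) * (2 ^ N : ℝ) ^ (-τ) := by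
          refine Finset.sum_le_sum fun u hu => ?_
          have hu' := Finset.mem_sdiff.1 hu
          rw [mem_zerosIn, mem_zerosIn] at hu'
          have h2 : (2 : ℝ) ^ N ≤ ‖u‖ := by
            by_contra hlt
            exact hu'.2 ⟨hu'.1.1, (not_le.1 hlt).le⟩
          exact mul_le_mul_of_nonneg_left
            (Real.rpow_le_rpow_of_nonpos (by positivity) h2 (by linarith)) (Nat.cast_nonneg _)
      _ = (∑ u ∈ zerosIn hf ha (2 ^ (N + 1)) \ zerosIn hf ha (2 ^ N), (m u : ℝ)) *
            (2 ^ N : ℝ) ^ (-τ) := by rw [Finset.sum_mul]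
      _ ≤ (∑ u ∈ zerosIn hf ha (2 ^ (N + 1)), (m u : ℝ)) * (2 ^ N : ℝ) ^ (-τ) := by
          refine mul_le_mul_of_nonneg_right ?_ (by positivity)
          exact Finset.sum_le_sum_of_subset_of_nonneg Finset.sdiff_subset
            fun _ _ _ => Nat.cast_nonneg _
      _ ≤ A * (4 * 2 ^ (N + 1)) ^ σ * (2 ^ N : ℝ) ^ (-τ) := by
          gcongr
          exact hcount _ (one_le_pow₀ (one_le_two : (1 : ℝ) ≤ 2))
      _ = A * 8 ^ σ * q ^ N := by
          have h1 : (4 * 2 ^ (N + 1) : ℝ) = 8 * 2 ^ N := by ring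
          have h2 : q ^ N = ((2 : ℝ) ^ N) ^ (σ - τ) := by
            rw [hq, ← Real.rpow_natCast, ← Real.rpow_natCast, ← Real.rpow_mul (by norm_num),
              ← Real.rpow_mul (by norm_num), mul_comm]
          rw [h1, h2, Real.mul_rpow (by norm_num) (by positivity), sub_eq_add_neg,
            Real.rpow_add (by positivity)]
          ring
  have hbound : ∀ N, T N ≤ T 0 + A * 8 ^ σ * ∑ k ∈ Finset.range N, q ^ k := by
    intro N
    induction N with
    | zero => simp
    | succ N ih =>
      rw [Finset.sum_range_succ, mul_add]
      linarith [hstep N]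
  have hgeom : ∀ N, ∑ k ∈ Finset.range N, q ^ k ≤ (1 - q)⁻¹ := fun N => by
    rw [← tsum_geometric_of_lt_one hq0.le hq1]
    exact (summable_geometric_of_lt_one hq0.le hq1).sum_le_tsum _ fun _ _ => by positivity
  refine summable_of_sum_le (c := T 0 + A * 8 ^ σ * (1 - q)⁻¹)
    (fun i => Real.rpow_nonneg (norm_nonneg _) _) fun s => ?_
  obtain ⟨N, hN⟩ := (((tendsto_zeroIndexIn hf ha).comp
    (tendsto_pow_atTop_atTop_of_one_lt (one_lt_two : (1 : ℝ) < 2))).eventually_ge_atTop s).exists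
  calc ∑ i ∈ s, ‖(i.1 : ℂ)‖ ^ (-τ) ≤ ∑ i ∈ zeroIndexIn hf ha (2 ^ N), ‖(i.1 : ℂ)‖ ^ (-τ) :=
        Finset.sum_le_sum_of_subset_of_nonneg hN
          fun _ _ _ => Real.rpow_nonneg (norm_nonneg _) _
    _ = T N := sum_zeroIndexIn hf ha _ fun u => ‖u‖ ^ (-τ)
    _ ≤ _ := (hbound N).trans (by
      gcongr
      exact hgeom N)

/-- **Hadamard factorisation** for entire functions of order less than one. -/
lemma hasProd_zeros {f : ℂ → ℂ} (hf : Differentiable ℂ f) (h0 : f 0 = 1) {A σ : ℝ}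
    (hA : 0 < A) (hσ : 0 < σ) (hσ1 : σ < 1)
    (hG : ∀ R : ℝ, 1 ≤ R → ∀ z, ‖z‖ ≤ R → ‖f z‖ ≤ Real.exp (A * R ^ σ)) (z : ℂ) :
    HasProd (fun i : ZeroIndex f => 1 - z / i.1) (f z) := by
  have ha : f 0 ≠ 0 := by simp [h0]
  have hsum : Summable fun i : ZeroIndex f => ‖-(z / i.1)‖ := by
    have := (summable_zeros_rpow_neg hf h0 hA hσ hσ1 hG).mul_left ‖z‖
    refine this.congr fun i => ?_
    rw [norm_neg, norm_div, Real.rpow_neg_one, div_eq_mul_inv]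
  have hmul : Multipliable fun i : ZeroIndex f => 1 - z / i.1 := by
    simpa [sub_eq_add_neg] using multipliable_one_add_of_summable hsum
  have hlim := hmul.hasProd.comp (tendsto_zeroIndexIn hf ha)
  have hex : ∀ S : ℝ, 1 ≤ S → 2 * ‖z‖ < S → ∃ ζ : ℂ,
      f z = (∏ i ∈ zeroIndexIn hf ha S, (1 - z / i.1)) * Complex.exp ζ ∧
      ‖ζ‖ ≤ 4 * (A * 4 ^ σ) * ‖z‖ * S ^ (-(1 - σ)) := by
    intro S hS hzS
    have hM : 0 < A * (4 * S) ^ σ := by positivity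
    obtain ⟨ζ, h1, h2⟩ := (exists_cofactor_near_one hf h0 ha (by linarith) hM
      fun w hw => hG (4 * S) (by linarith) w hw.le).2 z (by linarith [norm_nonneg z])
    refine ⟨ζ, ?_, h2.trans ?_⟩
    · rw [h1]
      congr 1
      exact (prod_zeroIndexIn hf ha S fun u => 1 - z / u).symm
    · have hS0 : 0 < S := by linarith
      calc 2 * (A * (4 * S) ^ σ) * ‖z‖ / (S - ‖z‖)
          ≤ 2 * (A * (4 * S) ^ σ) * ‖z‖ / (S / 2) := by
            gcongr
            linarith
        _ = 4 * (A * 4 ^ σ) * ‖z‖ * S ^ (-(1 - σ)) := by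
            rw [Real.mul_rpow (by norm_num) hS0.le, show -(1 - σ) = σ - 1 by ring,
              Real.rpow_sub_one hS0.ne']
            field_simp
            ring
  choose! ζ hζ1 hζ2 using hex
  have hζ : Tendsto ζ atTop (𝓝 0) := by
    refine squeeze_zero_norm' (a := fun S => 4 * (A * 4 ^ σ) * ‖z‖ * S ^ (-(1 - σ))) ?_ ?_
    · filter_upwards [eventually_ge_atTop 1, eventually_gt_atTop (2 * ‖z‖)] with S h1 h2
        using hζ2 S h1 h2
    · simpa using (tendsto_rpow_neg_atTop (by linarith : 0 < 1 - σ)).const_mul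
        (4 * (A * 4 ^ σ) * ‖z‖)
  have hlim2 := hlim.mul ((Complex.continuous_exp.tendsto 0).comp hζ)
  have heq : f z = ∏' i : ZeroIndex f, (1 - z / i.1) := by
    rw [Complex.exp_zero, mul_one] at hlim2
    refine tendsto_nhds_unique (tendsto_const_nhds.congr' ?_) hlim2
    filter_upwards [eventually_ge_atTop 1, eventually_gt_atTop (2 * ‖z‖)] with S h1 h2
      using hζ1 S h1 h2
  rw [heq]
  exact hmul.hasProd

/-! ### Linear growth from a small minimum modulus -/

/-- A function of order less than `1/2` that grows at most linearly on the positive axis is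
affine. -/
lemma affine_of_growth_of_bound {F : ℂ → ℂ} (hF : Differentiable ℂ F) {B τ : ℝ} (hB : 0 ≤ B)
    (hτ : τ < 1 / 2) (hg : ∀ z, ‖F z‖ ≤ Real.exp (B * ‖z‖ ^ τ)) {K r₀ : ℝ}
    (hK : ∀ r : ℝ, r₀ ≤ r → ‖F r‖ ≤ K * r) : ∃ b : ℂ, ∀ z, F z = F 0 + b * z := by
  set H := dslope F 0 with hH
  have hHd : Differentiable ℂ H := by
    rw [← differentiableOn_univ, hH]
    exact (Complex.differentiableOn_dslope univ_mem).2 hF.differentiableOn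
  have hHne : ∀ z, z ≠ 0 → H z = (F z - F 0) / z := by
    intro z hz
    rw [hH, dslope_of_ne _ hz, slope_def_field, sub_zero]
  obtain ⟨C₁, hC₁⟩ := (isCompact_Icc (a := (0 : ℝ)) (b := max r₀ 1)).exists_bound_of_continuousOn
    (f := fun r : ℝ => H r) (hHd.continuous.comp Complex.continuous_ofReal).continuousOn
  set C := max C₁ (K + ‖F 0‖) with hC
  have hax : ∀ r : ℝ, 0 ≤ r → ‖H r‖ ≤ C := by
    intro r hr
    rcases le_total r (max r₀ 1) with h | h
    · exact (hC₁ r ⟨hr, h⟩).trans (le_max_left _ _)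
    · refine le_trans ?_ (le_max_right _ _)
      have h1 : 1 ≤ r := (le_max_right _ _).trans h
      have h2 : r₀ ≤ r := (le_max_left _ _).trans h
      rw [hHne r (by exact_mod_cast (by linarith : r ≠ 0)), norm_div, Complex.norm_real,
        Real.norm_of_nonneg hr, div_le_iff₀ (by linarith)]
      calc ‖F r - F 0‖ ≤ ‖F r‖ + ‖F 0‖ := norm_sub_le _ _
        _ ≤ K * r + ‖F 0‖ * r :=
          add_le_add (hK r h2) (le_mul_of_one_le_right (norm_nonneg _) h1)
        _ = _ := by ring
  -- The fourth power maps both coordinate axes onto the nonnegative real axis, where `H` is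
  -- bounded. The growth exponent becomes `4 * τ < 2`, below the Phragmén–Lindelöf threshold for a
  -- quadrant; this is where `1/2` enters.
  set G : ℂ → ℂ := fun z => H (z ^ 4) with hG
  have hGd : Differentiable ℂ G := hHd.comp (differentiable_pow 4)
  have hGO : ∀ s : Set ℂ, ∃ c < (2 : ℝ), ∃ B' : ℝ,
      G =O[Bornology.cobounded ℂ ⊓ 𝓟 s] fun z => Real.exp (B' * ‖z‖ ^ c) := by
    intro s
    refine ⟨4 * τ, by linarith, B, Asymptotics.IsBigO.mono ?_ inf_le_left⟩
    refine Asymptotics.IsBigO.of_bound (1 + ‖F 0‖) ?_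
    filter_upwards [(tendsto_norm_cobounded_atTop (E := ℂ)).eventually_ge_atTop 1] with z hz
    have hz0 : z ≠ 0 := by rintro rfl; norm_num at hz
    have h4 : 1 ≤ ‖z ^ 4‖ := by rw [norm_pow]; exact one_le_pow₀ hz
    have h5 : ‖z ^ 4‖ ^ τ = ‖z‖ ^ (4 * τ) := by
      rw [norm_pow, Real.rpow_mul (norm_nonneg _)]
      norm_num
    have h6 : 1 ≤ Real.exp (B * ‖z‖ ^ (4 * τ)) := Real.one_le_exp (by positivity)
    rw [hG]
    simp only
    rw [hHne _ (pow_ne_zero _ hz0), norm_div, Real.norm_of_nonneg (Real.exp_pos _).le]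
    calc ‖F (z ^ 4) - F 0‖ / ‖z ^ 4‖ ≤ ‖F (z ^ 4) - F 0‖ := div_le_self (norm_nonneg _) h4
      _ ≤ ‖F (z ^ 4)‖ + ‖F 0‖ := norm_sub_le _ _
      _ ≤ Real.exp (B * ‖z‖ ^ (4 * τ)) + ‖F 0‖ * Real.exp (B * ‖z‖ ^ (4 * τ)) := by
        refine add_le_add ?_ (le_mul_of_one_le_right (norm_nonneg _) h6)
        rw [← h5]; exact hg _
      _ = _ := by ring
  have hre : ∀ x : ℝ, ‖G x‖ ≤ C := fun x => by
    have : G x = H ((x ^ 4 : ℝ) : ℂ) := by simp [hG]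
    rw [this]; exact hax _ (by positivity)
  have him : ∀ x : ℝ, ‖G (x * Complex.I)‖ ≤ C := fun x => by
    have : G (x * Complex.I) = H ((x ^ 4 : ℝ) : ℂ) := by simp [hG, mul_pow]
    rw [this]; exact hax _ (by positivity)
  have hGb : ∀ z, ‖G z‖ ≤ C := by
    intro z
    rcases le_total 0 z.re with h1 | h1 <;> rcases le_total 0 z.im with h2 | h2
    · exact PhragmenLindelof.quadrant_I hGd.diffContOnCl (hGO _) (fun x _ => hre x)
        (fun x _ => him x) h1 h2
    · exact PhragmenLindelof.quadrant_IV hGd.diffContOnCl (hGO _) (fun x _ => hre x)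
        (fun x _ => him x) h1 h2
    · exact PhragmenLindelof.quadrant_II hGd.diffContOnCl (hGO _) (fun x _ => hre x)
        (fun x _ => him x) h1 h2
    · exact PhragmenLindelof.quadrant_III hGd.diffContOnCl (hGO _) (fun x _ => hre x)
        (fun x _ => him x) h1 h2
  have hHb : Bornology.IsBounded (Set.range H) := by
    refine isBounded_iff_forall_norm_le.2 ⟨C, ?_⟩
    rintro _ ⟨w, rfl⟩
    obtain ⟨z, hz⟩ := IsAlgClosed.exists_pow_nat_eq w (n := 4) (by norm_num)
    rw [← hz]; exact hGb z
  refine ⟨H 0, fun z => ?_⟩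
  rcases eq_or_ne z 0 with rfl | hz
  · simp
  · rw [hHd.apply_eq_apply_of_bounded hHb 0 z, hHne z hz]
    field_simp
    ring

/-- The canonical product of genus zero with prescribed zeros. -/
lemma exists_genus_zero_product {ι : Type*} {a : ι → ℝ} (ha : ∀ i, 0 < a i) {τ : ℝ} (hτ : 0 < τ)
    (hτ1 : τ ≤ 1) (hs1 : Summable fun i => a i ^ (-1 : ℝ)) (hsτ : Summable fun i => a i ^ (-τ)) :
    ∃ F : ℂ → ℂ, Differentiable ℂ F ∧ (∀ z, HasProd (fun i => 1 - z / (a i : ℂ)) (F z)) ∧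
      ∃ B, 0 ≤ B ∧ ∀ z, ‖F z‖ ≤ Real.exp (B * ‖z‖ ^ τ) := by
  have hsum : ∀ c : ℝ, Summable fun i => c * a i ^ (-1 : ℝ) := fun c => hs1.mul_left c
  have hmul : ∀ z : ℂ, Multipliable fun i => 1 - z / (a i : ℂ) := by
    intro z
    have : Summable fun i => ‖-(z / (a i : ℂ))‖ := by
      refine (hsum ‖z‖).congr fun i => ?_
      rw [norm_neg, norm_div, Real.rpow_neg_one, div_eq_mul_inv, Complex.norm_real,
        Real.norm_of_nonneg (ha i).le]
    simpa [sub_eq_add_neg] using multipliable_one_add_of_summable this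
  refine ⟨fun z => ∏' i, (1 - z / (a i : ℂ)), ?_, fun z => (hmul z).hasProd,
    τ⁻¹ * ∑' i, a i ^ (-τ), ?_, fun z => ?_⟩
  · have hloc : HasProdLocallyUniformlyOn (fun i (z : ℂ) => 1 + -(z / (a i : ℂ)))
        (fun z => ∏' i, (1 + -(z / (a i : ℂ)))) Set.univ := by
      refine hasProdLocallyUniformlyOn_of_forall_compact isOpen_univ fun K _ hK => ?_
      obtain ⟨c, hc⟩ := hK.isBounded.exists_norm_le
      refine (hsum c).hasProdUniformlyOn_one_add hK (Eventually.of_forall fun i z hz => ?_)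
        fun i => by fun_prop
      rw [norm_neg, norm_div, Real.rpow_neg_one, div_eq_mul_inv, Complex.norm_real,
        Real.norm_of_nonneg (ha i).le]
      exact mul_le_mul_of_nonneg_right (hc z hz) (inv_nonneg.2 (ha i).le)
    have := hloc.differentiableOn (.of_forall fun s => by
      simpa [Finset.prod_fn] using DifferentiableOn.finsetProd (fun _ _ ↦ by fun_prop)) isOpen_univ
    simpa [sub_eq_add_neg, differentiableOn_univ] using this
  · exact mul_nonneg (inv_nonneg.2 hτ.le) (tsum_nonneg fun i => Real.rpow_nonneg (ha i).le _)
  · refine le_of_tendsto (hmul z).hasProd.norm (Eventually.of_forall fun s => ?_)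
    simp only
    calc ∏ i ∈ s, ‖1 - z / (a i : ℂ)‖ ≤ ∏ i ∈ s, Real.exp (τ⁻¹ * ‖z‖ ^ τ * a i ^ (-τ)) := by
          refine Finset.prod_le_prod (fun _ _ => norm_nonneg _) fun i _ => ?_
          set x := ‖z‖ / a i with hx
          have hx0 : 0 ≤ x := div_nonneg (norm_nonneg _) (ha i).le
          have h1 : ‖1 - z / (a i : ℂ)‖ ≤ 1 + x := by
            refine (norm_sub_le _ _).trans ?_
            rw [norm_one, norm_div, Complex.norm_real, Real.norm_of_nonneg (ha i).le]
          -- Subadditivity of `t ↦ t ^ τ` for `τ ≤ 1` gives `(1 + x) ^ τ ≤ 1 + x ^ τ`; taking the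
          -- root of order `τ` then yields the factor `τ⁻¹` in the exponent.
          have h2 : (1 + x) ^ τ ≤ Real.exp (x ^ τ) := by
            have := Real.rpow_add_le_add_rpow zero_le_one hx0 hτ.le hτ1
            rw [Real.one_rpow] at this
            linarith [Real.add_one_le_exp (x ^ τ)]
          have h3 : 1 + x ≤ Real.exp (τ⁻¹ * x ^ τ) := by
            have := Real.rpow_le_rpow (by positivity) h2 (inv_nonneg.2 hτ.le)
            rwa [← Real.rpow_mul (by positivity), mul_inv_cancel₀ hτ.ne', Real.rpow_one,
              ← Real.exp_mul, mul_comm] at this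
          refine h1.trans (h3.trans (le_of_eq ?_))
          rw [hx, Real.div_rpow (norm_nonneg _) (ha i).le, Real.rpow_neg (ha i).le, mul_assoc,
            div_eq_mul_inv]
      _ = Real.exp (τ⁻¹ * ‖z‖ ^ τ * ∑ i ∈ s, a i ^ (-τ)) := by
          rw [← Real.exp_sum, Finset.mul_sum]
      _ ≤ _ := by
          rw [Real.exp_le_exp]
          have := hsτ.sum_le_tsum s fun i _ => Real.rpow_nonneg (ha i).le _
          calc τ⁻¹ * ‖z‖ ^ τ * ∑ i ∈ s, a i ^ (-τ) ≤ τ⁻¹ * ‖z‖ ^ τ * ∑' i, a i ^ (-τ) := by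
                gcongr
            _ = _ := by ring

/-- If an entire function of order less than `1/2` is small somewhere on every large circle, then
it grows at most linearly. -/
lemma linear_growth_of_small_minimum {f : ℂ → ℂ} (hf : Differentiable ℂ f) (h0 : f 0 = 1) {A σ : ℝ}
    (hA : 0 < A) (hσ : 0 < σ) (hσ1 : σ < 1 / 2)
    (hG : ∀ R : ℝ, 1 ≤ R → ∀ z, ‖z‖ ≤ R → ‖f z‖ ≤ Real.exp (A * R ^ σ)) {K r₀ : ℝ}
    (hmin : ∀ r, r₀ ≤ r → ∃ z, ‖z‖ = r ∧ ‖f z‖ ≤ K * r) :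
    ∃ C, ∀ z, ‖f z‖ ≤ C * (1 + ‖z‖) := by
  obtain ⟨τ, hτ, hτ1⟩ := exists_between hσ1
  have hzero : ∀ i : ZeroIndex f, (i.1 : ℂ) ≠ 0 := by
    rintro ⟨⟨u, hu⟩, _⟩ h
    simp only at h
    rw [h, h0] at hu
    exact one_ne_zero hu
  -- `F` has the zeros of `f` rotated onto the positive axis. Comparing factors, `|1 - |z|/|u|| ≤ |1
  -- - z/u| ≤ 1 + |z|/|u|`.
  obtain ⟨F, hF, hFp, B, hB, hFB⟩ := exists_genus_zero_product (ι := ZeroIndex f)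
    (a := fun i => ‖(i.1 : ℂ)‖) (fun i => norm_pos_iff.2 (hzero i)) (hσ.trans hτ)
    (by linarith) (summable_zeros_rpow_neg hf h0 hA hσ (by linarith) hG)
    (summable_zeros_rpow_neg hf h0 hA hσ hτ hG)
  have hprod := hasProd_zeros hf h0 hA hσ (by linarith) hG
  have hlow : ∀ z, ‖F ‖z‖‖ ≤ ‖f z‖ := by
    intro z
    refine le_of_tendsto_of_tendsto' (hFp ‖z‖).norm (hprod z).norm fun s => ?_
    refine Finset.prod_le_prod (fun _ _ => norm_nonneg _) fun i _ => ?_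
    have h1 : (1 : ℂ) - (‖z‖ : ℂ) / (‖(i.1 : ℂ)‖ : ℂ) = ((‖(1 : ℂ)‖ - ‖z / i.1‖ : ℝ) : ℂ) := by
      simp
    rw [h1, Complex.norm_real]
    exact abs_norm_sub_norm_le _ _
  have hup : ∀ z, ‖f z‖ ≤ ‖F (-‖z‖ : ℂ)‖ := by
    intro z
    refine le_of_tendsto_of_tendsto' (hprod z).norm (hFp (-‖z‖)).norm fun s => ?_
    refine Finset.prod_le_prod (fun _ _ => norm_nonneg _) fun i _ => ?_
    have h1 : (1 : ℂ) - (-‖z‖ : ℂ) / (‖(i.1 : ℂ)‖ : ℂ) = ((1 + ‖z / i.1‖ : ℝ) : ℂ) := by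
      simp [neg_div]
    rw [h1, Complex.norm_real, Real.norm_of_nonneg (by positivity)]
    exact (norm_sub_le _ _).trans (by rw [norm_one])
  obtain ⟨b, hb⟩ := affine_of_growth_of_bound hF hB hτ1 hFB (K := K) (r₀ := r₀) fun r hr => by
    obtain ⟨z, rfl, hz⟩ := hmin r hr
    exact (hlow z).trans hz
  refine ⟨‖F 0‖ + ‖b‖, fun z => (hup z).trans ?_⟩
  rw [hb]
  calc ‖F 0 + b * (-‖z‖ : ℂ)‖ ≤ ‖F 0‖ + ‖b * (-‖z‖ : ℂ)‖ := norm_add_le _ _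
    _ = ‖F 0‖ + ‖b‖ * ‖z‖ := by simp
    _ ≤ _ := by nlinarith [norm_nonneg (F 0), norm_nonneg b, norm_nonneg z]

/-! ### Maximum modulus, order and Wiman's theorem -/

lemma norm_le_maxModulus {f : ℂ → ℂ} (hf : Differentiable ℂ f) {r : ℝ} {z : ℂ} (hz : ‖z‖ = r) :
    ‖f z‖ ≤ maxModulus f r := by
  refine le_csSup ?_ ⟨z, by simpa using hz, rfl⟩
  exact ((isCompact_sphere (0 : ℂ) r).image hf.continuous.norm).bddAbove

lemma norm_le_maxModulus_of_le {f : ℂ → ℂ} (hf : Differentiable ℂ f) {r : ℝ} (hr : 0 < r) {z : ℂ}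
    (hz : ‖z‖ ≤ r) : ‖f z‖ ≤ maxModulus f r :=
  norm_le_of_sphere hf hr.ne' (fun _ hw => norm_le_maxModulus hf hw) hz

lemma maxModulus_le {f : ℂ → ℂ} {r C : ℝ} (hr : 0 ≤ r) (h : ∀ z, ‖z‖ = r → ‖f z‖ ≤ C) :
    maxModulus f r ≤ C := by
  refine csSup_le ((NormedSpace.sphere_nonempty.2 hr).image _) ?_
  rintro _ ⟨z, hz, rfl⟩
  exact h z (by simpa using hz)

/-- The growth of a function whose order is less than `σ`. -/
lemma exists_growth_bound {f : ℂ → ℂ} (hf : Differentiable ℂ f) {σ : ℝ}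
    (hord : growthOrder f < (σ : EReal)) :
    ∃ A, 0 < A ∧ ∀ R : ℝ, 1 ≤ R → ∀ z, ‖z‖ ≤ R → ‖f z‖ ≤ Real.exp (A * R ^ σ) := by
  have hev := eventually_lt_of_limsup_lt hord
  obtain ⟨r₀, hr₀⟩ := (hev.and (eventually_gt_atTop 1)).exists_forall_of_atTop
  set r₁ := max r₀ 1 with hr₁
  have h1 : ∀ r, r₁ ≤ r → maxModulus f r ≤ Real.exp (r ^ σ) := by
    intro r hr
    obtain ⟨h2, h3⟩ := hr₀ r ((le_max_left _ _).trans hr)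
    have h2' := EReal.coe_lt_coe_iff.1 h2
    have hlog : 0 < Real.log r := Real.log_pos h3
    rw [div_lt_iff₀ hlog] at h2'
    -- `Real.log x` is `log |x|`, so the double logarithm is informative only when the inner one is
    -- positive; otherwise the bound is trivial.
    have hM : Real.log (maxModulus f r) ≤ r ^ σ := by
      rcases le_or_gt (Real.log (maxModulus f r)) 0 with h4 | h4
      · exact h4.trans (Real.rpow_nonneg (by linarith) _)
      · rw [← Real.log_rpow (by linarith)] at h2'
        exact ((Real.log_lt_log_iff h4 (Real.rpow_pos_of_pos (by linarith) _)).1 h2').le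
    rcases le_or_gt (maxModulus f r) 0 with h5 | h5
    · exact h5.trans (Real.exp_pos _).le
    · rwa [← Real.log_le_iff_le_exp h5]
  have hr₁0 : 1 ≤ r₁ := le_max_right _ _
  -- For `1 ≤ R` the radius `r₁ * R` lies in the range of `h1`; enlarging the disc to it costs only
  -- the constant `r₁ ^ σ`.
  refine ⟨r₁ ^ σ, by positivity, fun R hR z hz => ?_⟩
  have h2 : ‖z‖ ≤ r₁ * R := hz.trans (le_mul_of_one_le_left (by linarith) hr₁0)
  rw [← Real.mul_rpow (by linarith) (by linarith)]
  exact (norm_le_maxModulus_of_le hf (by positivity) h2).trans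
    (h1 _ (le_mul_of_one_le_right (by linarith) hR))

/-- A function that grows at most linearly is not of positive order. -/
lemma not_linear_growth {f : ℂ → ℂ} (hf : Differentiable ℂ f) {ρ : ℝ} (hρ : 0 < ρ)
    (hord : growthOrder f = (ρ : EReal)) (C : ℝ) : ¬ ∀ z, ‖f z‖ ≤ C * (1 + ‖z‖) := by
  intro hC
  have hfr : ∃ᶠ r : ℝ in atTop,
      ((ρ / 2 : ℝ) : EReal) < ((Real.log (Real.log (maxModulus f r)) / Real.log r : ℝ) : EReal) := by
    refine frequently_lt_of_lt_limsup (by isBoundedDefault) ?_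
    have : growthOrder f > ((ρ / 2 : ℝ) : EReal) := by
      rw [hord]; exact EReal.coe_lt_coe_iff.2 (by linarith)
    exact this
  -- The absolute value is forced by `Real.log x = log |x|`: a large quotient could also stem from a
  -- tiny maximum modulus. That is excluded below by `δ ≤ maxModulus f r`, or by `log 0 = 0` if `f`
  -- vanishes identically.
  have hkey : ∃ᶠ r : ℝ in atTop, 1 < r ∧ r ^ (ρ / 2) < |Real.log (maxModulus f r)| := by
    refine (hfr.and_eventually (eventually_gt_atTop 1)).mono fun r hr => ⟨hr.2, ?_⟩
    have h1 := EReal.coe_lt_coe_iff.1 hr.1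
    have hlog : 0 < Real.log r := Real.log_pos hr.2
    rw [lt_div_iff₀ hlog, ← Real.log_rpow (by linarith [hr.2]),
      ← Real.log_abs (Real.log (maxModulus f r))] at h1
    have hne : |Real.log (maxModulus f r)| ≠ 0 := by
      intro h
      rw [h, Real.log_zero, Real.log_rpow (by linarith [hr.2])] at h1
      nlinarith
    exact (Real.log_lt_log_iff (Real.rpow_pos_of_pos (by linarith [hr.2]) _)
      (lt_of_le_of_ne (abs_nonneg _) hne.symm)).1 h1
  by_cases hz : ∃ z₁, f z₁ ≠ 0
  · obtain ⟨z₁, hz₁⟩ := hz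
    set δ := ‖f z₁‖
    have hδ : 0 < δ := norm_pos_iff.2 hz₁
    set D := |Real.log δ| + |Real.log ((|C| + 1) * 2)| with hD
    have hlim : Tendsto (fun r : ℝ => (D + Real.log r) / r ^ (ρ / 2)) atTop (𝓝 0) := by
      have h1 := (tendsto_rpow_neg_atTop (half_pos hρ)).const_mul D
      have h2 := (isLittleO_log_rpow_atTop (half_pos hρ)).tendsto_div_nhds_zero
      have h3 := h1.add h2
      rw [mul_zero, add_zero] at h3
      refine h3.congr' ?_
      filter_upwards [eventually_gt_atTop 0] with r hr
      rw [Real.rpow_neg hr.le]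
      field_simp
    obtain ⟨r, ⟨hr1, hr2⟩, hr3, hr4⟩ := (hkey.and_eventually
      ((hlim.eventually_lt_const one_pos).and (eventually_ge_atTop ‖z₁‖))).exists
    rw [div_lt_one (Real.rpow_pos_of_pos (by linarith) _)] at hr3
    have hM1 : δ ≤ maxModulus f r := norm_le_maxModulus_of_le hf (by linarith) hr4
    have hM2 : maxModulus f r ≤ (|C| + 1) * 2 * r := by
      refine maxModulus_le (by linarith) fun z hz => (hC z).trans ?_
      rw [hz]
      nlinarith [le_abs_self C, abs_nonneg C]
    have h1 : Real.log δ ≤ Real.log (maxModulus f r) := Real.log_le_log hδ hM1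
    have h2 : Real.log (maxModulus f r) ≤ Real.log ((|C| + 1) * 2) + Real.log r := by
      rw [← Real.log_mul (by positivity) (by linarith)]
      exact Real.log_le_log (hδ.trans_le hM1) hM2
    have h3 : |Real.log (maxModulus f r)| ≤ D + Real.log r := by
      have hlr := (Real.log_pos hr1).le
      rw [abs_le]
      constructor
      · linarith [neg_abs_le (Real.log δ), abs_nonneg (Real.log ((|C| + 1) * 2))]
      · linarith [le_abs_self (Real.log ((|C| + 1) * 2)), abs_nonneg (Real.log δ)]
    linarith
  · push Not at hz
    obtain ⟨r, hr1, hr2⟩ := hkey.exists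
    have hr0 : 0 < r := by linarith
    have : maxModulus f r = 0 := le_antisymm
      (maxModulus_le hr0.le fun z _ => by simp [hz])
      ((norm_nonneg _).trans (norm_le_maxModulus_of_le hf hr0 (norm_zero.le.trans hr0.le)))
    rw [this, Real.log_zero, abs_zero] at hr2
    exact absurd hr2 (not_lt.2 (Real.rpow_nonneg (by linarith) _))

/-- A form of **Wiman's theorem**: the minimum modulus of an entire function of order in
`(0, 1/2)` exceeds every linear function on arbitrarily large circles. -/
theorem exists_circle_large_minimum {f : ℂ → ℂ} (hf : Differentiable ℂ f) {ρ : ℝ} (hρ0 : 0 < ρ)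
    (hρ1 : ρ < 1 / 2) (hord : growthOrder f = (ρ : EReal)) (K r₀ : ℝ) :
    ∃ r, r₀ ≤ r ∧ ∀ z, ‖z‖ = r → K * r < ‖f z‖ := by
  by_contra hcon
  push Not at hcon
  obtain ⟨σ, hσ, hσ1⟩ := exists_between hρ1
  obtain ⟨A, hA, hG⟩ := exists_growth_bound hf
    (by rw [hord]; exact EReal.coe_lt_coe_iff.2 hσ)
  -- Subtracting a constant normalises the value at `0` to `1` even if `f 0 = 0`, and affects the
  -- growth and minimum bounds only through constants.
  set c := f 0 - 1 with hc
  obtain ⟨C, hC⟩ := linear_growth_of_small_minimum (f := fun z => f z - c) (hf.sub_const c)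
    (by simp [hc]) (A := A + ‖c‖) (by positivity) (hρ0.trans hσ) hσ1 (fun R hR z hz => by
      have h1 : 1 ≤ R ^ σ := Real.one_le_rpow hR (hρ0.trans hσ).le
      have h2 : 1 ≤ Real.exp (A * R ^ σ) := Real.one_le_exp (by positivity)
      calc ‖f z - c‖ ≤ ‖f z‖ + ‖c‖ := norm_sub_le _ _
        _ ≤ Real.exp (A * R ^ σ) + Real.exp (A * R ^ σ) * ‖c‖ :=
          add_le_add (hG R hR z hz) (le_mul_of_one_le_left (norm_nonneg _) h2)
        _ = Real.exp (A * R ^ σ) * (‖c‖ + 1) := by ring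
        _ ≤ Real.exp (A * R ^ σ) * Real.exp (‖c‖ * R ^ σ) := by
          gcongr
          refine (Real.add_one_le_exp _).trans (Real.exp_le_exp.2 ?_)
          exact le_mul_of_one_le_right (norm_nonneg _) h1
        _ = _ := by rw [← Real.exp_add]; ring_nf)
    (K := K + ‖c‖) (r₀ := max r₀ 1) fun r hr => by
      obtain ⟨z, hz1, hz2⟩ := hcon r ((le_max_left _ _).trans hr)
      refine ⟨z, hz1, (norm_sub_le _ _).trans ?_⟩
      have : 1 ≤ r := (le_max_right _ _).trans hr
      nlinarith [norm_nonneg c]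
  refine not_linear_growth hf hρ0 hord (C + ‖c‖) fun z => ?_
  have h1 := hC z
  have h2 : ‖f z‖ ≤ ‖f z - c‖ + ‖c‖ := by simpa using norm_add_le (f z - c) c
  nlinarith [norm_nonneg c, norm_nonneg z]

/-! ### Sums over the fibres of an entire function -/

/-- The weighted **argument principle** on a circle about the origin. -/
lemma circleIntegral_mul_logDeriv {F h : ℂ → ℂ} (hF : Differentiable ℂ F) (hh : Differentiable ℂ h)
    {R : ℝ} (hR : 0 < R) (hne : ∀ v, ‖v‖ = R → F v ≠ 0) {a : ℂ} (ha : F a ≠ 0) :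
    (∮ v in C(0, R), h v * logDeriv F v) =
      2 * Real.pi * Complex.I * ∑ u ∈ zerosIn hF ha R, (analyticOrderNatAt F u : ℂ) * h u := by
  set Z := zerosIn hF ha R with hZ
  obtain ⟨g, hg, hFg, hgZ⟩ := exists_entire_eq_prod_pow_mul hF ha Z
  set m := analyticOrderNatAt F
  have hsph : ∀ v ∈ Metric.sphere (0 : ℂ) R, ‖v‖ = R := fun v hv => by simpa using hv
  have hZR : ∀ u ∈ Z, ‖u‖ < R := fun u hu => by
    have := (mem_zerosIn hF ha).1 hu
    exact lt_of_le_of_ne this.2 fun h => hne u h this.1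
  have hgne : ∀ v, ‖v‖ ≤ R → g v ≠ 0 := fun v hv h0 =>
    hgZ v ((mem_zerosIn hF ha).2 ⟨by rw [hFg, h0, mul_zero], hv⟩) h0
  have hsub : ∀ u ∈ Z, ∀ v, ‖v‖ = R → v - u ≠ 0 := by
    rintro u hu v hv h
    rw [sub_eq_zero.1 h] at hv
    exact (hZR u hu).ne hv
  have hlog : Set.EqOn (fun v => h v * logDeriv F v)
      (fun v => (∑ u ∈ Z, (m u : ℂ) * ((v - u)⁻¹ * h v)) + h v * (deriv g v / g v))
      (Metric.sphere 0 R) := by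
    intro v hv
    have hv' := hsph v hv
    have h1 : logDeriv F v = (∑ u ∈ Z, (m u : ℂ) * (v - u)⁻¹) + deriv g v / g v := by
      rw [show F = fun v => (∏ u ∈ Z, (v - u) ^ m u) * g v from funext hFg,
        logDeriv_mul v (Finset.prod_ne_zero_iff.2 fun u hu => pow_ne_zero _ (hsub u hu v hv'))
          (hgne v hv'.le) (by fun_prop) (hg v),
        logDeriv_prod (f := fun u v => (v - u) ^ m u)
          (fun u hu => pow_ne_zero _ (hsub u hu v hv')) (fun u _ => by fun_prop)]
      congr 1
      refine Finset.sum_congr rfl fun u _ => ?_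
      rw [logDeriv_fun_pow (f := fun v => v - u) (by fun_prop)]
      simp [logDeriv_apply]
    simp only [h1, mul_add, Finset.mul_sum]
    congr 1
    exact Finset.sum_congr rfl fun u _ => by ring
  have hgd : DifferentiableOn ℂ (fun v => h v * (deriv g v / g v)) (Metric.closedBall 0 R) := by
    refine hh.differentiableOn.mul (DifferentiableOn.div ?_ hg.differentiableOn fun v hv =>
      hgne v (by simpa using hv))
    exact fun v _ => (hg.analyticAt v).deriv.differentiableAt.differentiableWithinAt
  have hci : ∀ u ∈ Z, CircleIntegrable (fun v => (m u : ℂ) * ((v - u)⁻¹ * h v)) 0 R := by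
    intro u hu
    refine ContinuousOn.circleIntegrable hR.le (continuousOn_const.mul
      (ContinuousOn.mul (ContinuousOn.inv₀ (by fun_prop) fun v hv => hsub u hu v (hsph v hv))
        hh.continuous.continuousOn))
  rw [circleIntegral.integral_congr hR.le hlog, circleIntegral.integral_add
    (CircleIntegrable.fun_sum _ hci)
    ((hgd.continuousOn.mono Metric.sphere_subset_closedBall).circleIntegrable hR.le),
    circleIntegral.integral_fun_sum hci,
    (hgd.mono Metric.closure_ball_subset_closedBall).diffContOnCl.circleIntegral_eq_zero hR.le,
    add_zero, Finset.mul_sum]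
  refine Finset.sum_congr rfl fun u hu => ?_
  rw [circleIntegral.integral_const_mul]
  have := hh.differentiableOn.circleIntegral_sub_inv_smul (c := 0) (R := R) (w := u)
    (by simpa using hZR u hu)
  simp only [smul_eq_mul] at this
  rw [this]
  ring

/-- The sum of `h` over the solutions of `f u = c` in a disc, counted with multiplicity. -/
noncomputable def fibreSum (f h : ℂ → ℂ) (R : ℝ) (c : ℂ) : ℂ :=
  ∑ᶠ u ∈ {u : ℂ | f u = c ∧ ‖u‖ < R}, ((analyticOrderAt (fun v => f v - c) u).toNat : ℂ) * h u

lemma autSum_eq_fibreSum (f : ℂ → ℂ) (R : ℝ) (w : ℂ) :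
    autSum f R w = fibreSum f (fun v => v) R (f w) := rfl

lemma fibre_eq_zerosIn {f : ℂ → ℂ} (hf : Differentiable ℂ f) {R : ℝ} {c : ℂ}
    (hne : ∀ v, ‖v‖ = R → f v ≠ c) {a : ℂ} (ha : f a - c ≠ 0) :
    {u : ℂ | f u = c ∧ ‖u‖ < R} = zerosIn (hf.sub_const c) ha R := by
  ext u
  rw [Finset.mem_coe, mem_zerosIn (hf.sub_const c) ha]
  simp only [Set.mem_ofPred_eq, sub_eq_zero]
  exact ⟨fun h => ⟨h.1, h.2.le⟩, fun h => ⟨h.1, lt_of_le_of_ne h.2 fun hu => hne u hu h.1⟩⟩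

lemma fibreSum_eq_sum {f : ℂ → ℂ} (hf : Differentiable ℂ f) (h : ℂ → ℂ) {R : ℝ} {c : ℂ}
    (hne : ∀ v, ‖v‖ = R → f v ≠ c) {a : ℂ} (ha : f a - c ≠ 0) :
    fibreSum f h R c = ∑ u ∈ zerosIn (hf.sub_const c) ha R,
      (analyticOrderNatAt (fun v => f v - c) u : ℂ) * h u := by
  rw [fibreSum, fibre_eq_zerosIn hf hne ha, finsum_mem_coe_finset]
  rfl

lemma fibreSum_eq_circleIntegral {f h : ℂ → ℂ} (hf : Differentiable ℂ f) (hh : Differentiable ℂ h)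
    {R : ℝ} (hR : 0 < R) {c : ℂ} (hne : ∀ v, ‖v‖ = R → f v ≠ c) :
    fibreSum f h R c =
      (2 * Real.pi * Complex.I : ℂ)⁻¹ * ∮ v in C(0, R), h v * deriv f v / (f v - c) := by
  have hR' : ‖(R : ℂ)‖ = R := by simp [hR.le]
  have ha : f R - c ≠ 0 := sub_ne_zero.2 (hne R hR')
  rw [fibreSum_eq_sum hf h hne ha]
  have key := circleIntegral_mul_logDeriv (hf.sub_const c) hh hR
    (fun v hv => sub_ne_zero.2 (hne v hv)) ha
  have h1 : (fun v => h v * deriv f v / (f v - c)) = fun v => h v * logDeriv (fun v => f v - c) v := by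
    ext v
    rw [logDeriv_apply, deriv_sub_const, mul_div_assoc]
  rw [h1, key, inv_mul_cancel_left₀ Complex.two_pi_I_ne_zero]

/-- Integration by parts: the dependence of `fibreSum` on the value `c`. -/
lemma fibreSum_sub_fibreSum_zero {f h : ℂ → ℂ} (hf : Differentiable ℂ f) (hh : Differentiable ℂ h)
    {R : ℝ} (hR : 0 < R) {c : ℂ} (hc : ∀ v, ‖v‖ = R → ‖c‖ < ‖f v‖) :
    fibreSum f h R c - fibreSum f h R 0 =
      -((2 * Real.pi * Complex.I : ℂ)⁻¹ *
        ∮ v in C(0, R), deriv h v * Complex.log (1 - c / f v)) := by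
  have hsph : ∀ v ∈ Metric.sphere (0 : ℂ) R, ‖v‖ = R := fun v hv => by simpa using hv
  have hf0 : ∀ v, ‖v‖ = R → f v ≠ 0 := fun v hv =>
    norm_pos_iff.1 ((norm_nonneg c).trans_lt (hc v hv))
  have hfc : ∀ v, ‖v‖ = R → f v ≠ c := fun v hv h => (hc v hv).ne (by rw [h])
  have hfc' : ∀ v, ‖v‖ = R → f v - c ≠ 0 := fun v hv => sub_ne_zero.2 (hfc v hv)
  -- Since `|c / f v| < 1`, the value `1 - c / f v` has positive real part, so the principal
  -- logarithm is holomorphic near the circle and `h · log (1 - c / f)` is a single-valued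
  -- primitive.
  have hslit : ∀ v, ‖v‖ = R → 1 - c / f v ∈ Complex.slitPlane := by
    intro v hv
    refine Or.inl ?_
    have h1 : ‖c / f v‖ < 1 := by
      rw [norm_div, div_lt_one (norm_pos_iff.2 (hf0 v hv))]; exact hc v hv
    have h2 := (Complex.re_le_norm (c / f v)).trans_lt h1
    simpa using h2
  have hderiv : ∀ v, ‖v‖ = R → HasDerivAt (fun v => h v * Complex.log (1 - c / f v))
      (deriv h v * Complex.log (1 - c / f v) +
        (h v * deriv f v / (f v - c) - h v * deriv f v / (f v - 0))) v := by
    intro v hv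
    have h1 := hf0 v hv
    have h2 := hfc' v hv
    have hq : HasDerivAt (fun v => 1 - c / f v) (-(-(c * deriv f v) / f v ^ 2)) v := by
      have := ((hasDerivAt_const v c).fun_div (hf v).hasDerivAt h1).const_sub 1
      simpa using this
    refine ((hh v).hasDerivAt.fun_mul (hq.clog (hslit v hv))).congr_deriv ?_
    have h3 : 1 - c / f v ≠ 0 := Complex.slitPlane_ne_zero (hslit v hv)
    have h4 : 1 - c / f v = (f v - c) / f v := by field_simp
    rw [sub_zero]
    congr 1
    rw [h4]
    field_simp
    ring
  have hint := circleIntegral.integral_eq_zero_of_hasDerivWithinAt (c := 0) hR.le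
    fun v hv => (hderiv v (hsph v hv)).hasDerivWithinAt
  have hdf : Continuous (deriv f) :=
    continuous_iff_continuousAt.2 fun v => (hf.analyticAt v).deriv.continuousAt
  have hdh : Continuous (deriv h) :=
    continuous_iff_continuousAt.2 fun v => (hh.analyticAt v).deriv.continuousAt
  have hfcont := hf.continuous
  have hhcont := hh.continuous
  have i1 : CircleIntegrable (fun v => h v * deriv f v / (f v - c)) 0 R :=
    ContinuousOn.circleIntegrable hR.le
      (ContinuousOn.div (by fun_prop) (by fun_prop) fun v hv => hfc' v (hsph v hv))
  have i2 : CircleIntegrable (fun v => h v * deriv f v / (f v - 0)) 0 R :=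
    ContinuousOn.circleIntegrable hR.le
      (ContinuousOn.div (by fun_prop) (by fun_prop) fun v hv => by
        rw [sub_zero]; exact hf0 v (hsph v hv))
  have i3 : CircleIntegrable (fun v => deriv h v * Complex.log (1 - c / f v)) 0 R :=
    ContinuousOn.circleIntegrable hR.le (hdh.continuousOn.mul
      (ContinuousOn.clog (continuousOn_const.sub
        (continuousOn_const.div hfcont.continuousOn fun v hv => hf0 v (hsph v hv)))
        fun v hv => hslit v (hsph v hv)))
  have i4 : CircleIntegrable
      (fun v => h v * deriv f v / (f v - c) - h v * deriv f v / (f v - 0)) 0 R := i1.sub i2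
  rw [circleIntegral.integral_add i3 i4, circleIntegral.integral_sub i1 i2] at hint
  rw [fibreSum_eq_circleIntegral hf hh hR hfc, fibreSum_eq_circleIntegral hf hh hR hf0]
  linear_combination (2 * Real.pi * Complex.I : ℂ)⁻¹ * hint

/-- The number of solutions does not depend on `c`. -/
lemma fibreSum_one_eq {f : ℂ → ℂ} (hf : Differentiable ℂ f)
    {R : ℝ} (hR : 0 < R) {c : ℂ} (hc : ∀ v, ‖v‖ = R → ‖c‖ < ‖f v‖) :
    fibreSum f (fun _ => 1) R c = fibreSum f (fun _ => 1) R 0 := by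
  have := fibreSum_sub_fibreSum_zero hf (differentiable_const (1 : ℂ)) hR hc
  simp only [deriv_const', zero_mul] at this
  simpa [circleIntegral, sub_eq_zero] using this

/-- The integrand is `log (1 - c / f v)` with `|c / f v| ≤ 1/2`, where `|log (1 - x)| ≤ (3/2) |x|`;
the length of the circle, divided by `2π`, supplies the factor `R`. The bound is small once `m` is
much larger than `R`. -/
lemma norm_fibreSum_sub_le {f : ℂ → ℂ} (hf : Differentiable ℂ f) {R m : ℝ} (hR : 0 < R)
    (hm : 0 < m) {c : ℂ} (hfm : ∀ v, ‖v‖ = R → m ≤ ‖f v‖) (hc : 2 * ‖c‖ ≤ m) :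
    ‖fibreSum f (fun v => v) R c - fibreSum f (fun v => v) R 0‖ ≤ R * (3 / 2 * (‖c‖ / m)) := by
  rw [fibreSum_sub_fibreSum_zero hf (h := fun v => v) differentiable_fun_id hR
    fun v hv => by linarith [hfm v hv, norm_nonneg c], norm_neg]
  refine circleIntegral.norm_two_pi_i_inv_smul_integral_le_of_norm_le_const hR.le fun v hv => ?_
  have hv' : ‖v‖ = R := by simpa using hv
  have h1 : ‖-(c / f v)‖ ≤ ‖c‖ / m := by
    rw [norm_neg, norm_div]
    exact div_le_div_of_nonneg_left (norm_nonneg _) hm (hfm v hv')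
  have h2 : ‖c‖ / m ≤ 1 / 2 := by
    rw [div_le_iff₀ hm]; linarith
  have h3 := Complex.norm_log_one_add_half_le_self (h1.trans h2)
  rw [← sub_eq_add_neg] at h3
  have h4 : deriv (fun v : ℂ => v) v = 1 := deriv_id v
  rw [h4, one_mul]
  exact h3.trans (by gcongr)

/-- Differentiation under the integral sign: with `ε` half the gap between `‖c₀‖` and `m`, the
denominators `f v - c` stay at least `ε` in modulus for all `c` within `ε` of `c₀`. -/
lemma differentiableOn_fibreSum {f h : ℂ → ℂ} (hf : Differentiable ℂ f) (hh : Differentiable ℂ h)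
    {R m : ℝ} (hR : 0 < R) (hfm : ∀ v, ‖v‖ = R → m ≤ ‖f v‖) :
    DifferentiableOn ℂ (fibreSum f h R) (Metric.ball 0 m) := by
  have hne : ∀ c ∈ Metric.ball (0 : ℂ) m, ∀ v, ‖v‖ = R → f v ≠ c := by
    rintro c hc v hv rfl
    exact absurd (hfm v hv) (not_le.2 (by simpa using hc))
  refine DifferentiableOn.congr (f := fun c => (2 * Real.pi * Complex.I : ℂ)⁻¹ *
    ∮ v in C(0, R), h v * deriv f v / (f v - c)) ?_ fun c hc =>
      fibreSum_eq_circleIntegral hf hh hR (hne c hc)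
  refine DifferentiableOn.const_mul (fun c₀ hc₀ => ?_) _
  have hc₀' : ‖c₀‖ < m := by simpa using hc₀
  have hdf : Continuous (deriv f) :=
    continuous_iff_continuousAt.2 fun v => (hf.analyticAt v).deriv.continuousAt
  have hfcont := hf.continuous
  have hhcont := hh.continuous
  set γ := circleMap 0 R with hγ
  have hγc : Continuous γ := continuous_circleMap 0 R
  have hγd : Continuous (deriv γ) := by
    have : deriv γ = fun θ => circleMap 0 R θ * Complex.I := funext fun θ => deriv_circleMap 0 R θ
    rw [this]; fun_prop
  have hγn : ∀ θ, ‖γ θ‖ = R := fun θ => by simp [hγ, abs_of_pos hR]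
  set ε := (m - ‖c₀‖) / 2 with hε
  have hε0 : 0 < ε := by rw [hε]; linarith
  have hfar : ∀ c ∈ Metric.ball c₀ ε, ∀ θ, ε ≤ ‖f (γ θ) - c‖ := by
    intro c hc θ
    have h1 : ‖c - c₀‖ < ε := by simpa [dist_eq_norm] using hc
    have h2 : ‖c‖ ≤ ‖c - c₀‖ + ‖c₀‖ := by simpa using norm_add_le (c - c₀) c₀
    have h3 := norm_sub_norm_le (f (γ θ)) c
    have h4 := hfm _ (hγn θ)
    rw [hε] at *
    linarith
  have hcont : ∀ c ∈ Metric.ball c₀ ε, ∀ k : ℕ, Continuous fun θ =>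
      deriv γ θ * (h (γ θ) * deriv f (γ θ) / (f (γ θ) - c) ^ k) := by
    intro c hc k
    have : Continuous fun θ => f (γ θ) - c := by fun_prop
    refine hγd.mul (Continuous.div (by fun_prop) (this.pow k) fun θ => pow_ne_zero _ ?_)
    exact norm_pos_iff.1 (hε0.trans_le (hfar c hc θ))
  have hc₀ε := Metric.mem_ball_self hε0 (x := c₀)
  have key := (intervalIntegral.hasDerivAt_integral_of_dominated_loc_of_deriv_le
    (μ := MeasureTheory.volume) (a := 0) (b := 2 * Real.pi)
    (F := fun c θ => deriv γ θ * (h (γ θ) * deriv f (γ θ) / (f (γ θ) - c) ^ 1))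
    (F' := fun c θ => deriv γ θ * (h (γ θ) * deriv f (γ θ) / (f (γ θ) - c) ^ 2))
    (bound := fun θ => ‖deriv γ θ‖ * (‖h (γ θ) * deriv f (γ θ)‖ / ε ^ 2))
    (Metric.ball_mem_nhds c₀ hε0) ?_ ?_ ?_ ?_ ?_ ?_).2
  · simp only [pow_one] at key
    exact key.differentiableAt.differentiableWithinAt
  · filter_upwards [Metric.ball_mem_nhds c₀ hε0] with c hc
    exact (hcont c hc 1).aestronglyMeasurable
  · exact (hcont c₀ hc₀ε 1).intervalIntegrable _ _
  · exact (hcont c₀ hc₀ε 2).aestronglyMeasurable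
  · refine Eventually.of_forall fun θ _ c hc => ?_
    rw [norm_mul, norm_div, norm_pow]
    have := hfar c hc θ
    gcongr
  · exact Continuous.intervalIntegrable (by fun_prop) _ _
  · refine Eventually.of_forall fun θ _ c hc => ?_
    have h0 : f (γ θ) - c ≠ 0 := norm_pos_iff.1 (hε0.trans_le (hfar c hc θ))
    have h1 : HasDerivAt (fun c => (f (γ θ) - c)⁻¹) (((f (γ θ) - c) ^ 2)⁻¹) c := by
      have := ((hasDerivAt_id c).const_sub (f (γ θ))).fun_inv h0
      simpa using this
    simpa [div_eq_mul_inv, mul_assoc] using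
      (h1.const_mul (h (γ θ) * deriv f (γ θ))).const_mul (deriv γ θ)

/-! ### Branches of the automorphic functions -/

lemma apply_value_of_mem_autBranches {f : ℂ → ℂ} {w : ℂ} {φ : Germ (𝓝 w) ℂ}
    (h : φ ∈ autBranches f w) : f φ.value = f w := by
  obtain ⟨g, -, hg, rfl⟩ := h
  exact hg.self_of_nhds

/-- The multiplicity is one, and the local inverse `r` of `f` at `u` provides the branch `r ∘ f`.
Any other branch `g` through `u` satisfies `g = r ∘ f ∘ g = r ∘ f` near `z`. -/
lemma isUnbranchedAt_of_deriv_ne_zero {f : ℂ → ℂ} (hf : Differentiable ℂ f) {z u : ℂ}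
    (hu : f u = f z) (hd : deriv f u ≠ 0) : IsUnbranchedAt f z u := by
  have h1 : fibreMult f z u = 1 := by
    rw [fibreMult, ← hu]
    exact (hf.analyticAt u).analyticOrderAt_sub_eq_one_of_deriv_ne_zero hd
  rw [IsUnbranchedAt, h1, Set.encard_eq_one]
  have hs := (hf.analyticAt u).hasStrictDerivAt
  set r := hs.localInverse _ _ _ hd with hr
  have hra : AnalyticAt ℂ r (f z) := hu ▸ (hf.analyticAt u).analyticAt_localInverse hd
  have hru : r (f z) = u := by
    rw [← hu]; exact HasStrictFDerivAt.localInverse_apply_image ..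
  refine ⟨((r ∘ f : ℂ → ℂ) : Germ (𝓝 z) ℂ), Set.eq_singleton_iff_unique_mem.2 ⟨⟨⟨r ∘ f,
    hra.comp (hf.analyticAt z), ?_, rfl⟩, hru⟩, ?_⟩⟩
  · have h2 : ∀ᶠ x in 𝓝 (f z), f (r x) = x := hu ▸ hs.eventually_right_inverse hd
    exact (hf z).continuousAt.eventually h2
  · rintro φ ⟨⟨g, hg, hfg, rfl⟩, hgu⟩
    have hgu' : g z = u := hgu
    refine Germ.coe_eq.2 ?_
    have h2 : ∀ᶠ x in 𝓝 (g z), r (f x) = x := hgu' ▸ hs.eventually_left_inverse hd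
    filter_upwards [hg.continuousAt.eventually h2, hfg] with x hx1 hx2
    rw [Function.comp_apply, ← hx2, hx1]

/-- Critical values are isolated, as far as the critical points in a disc are concerned. -/
lemma eventually_deriv_ne_zero {f : ℂ → ℂ} (hf : Differentiable ℂ f) (hnc : ∀ c, ∃ a, f a ≠ c)
    (R : ℝ) (w : ℂ) : ∀ᶠ z in 𝓝[≠] w, ∀ u, f u = f z → ‖u‖ < R → deriv f u ≠ 0 := by
  have hd : Differentiable ℂ (deriv f) := fun z => (hf.analyticAt z).deriv.differentiableAt
  obtain ⟨a, ha⟩ : ∃ a, deriv f a ≠ 0 := by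
    by_contra hcon
    push Not at hcon
    obtain ⟨b, hb⟩ := hnc (f 0)
    exact hb (is_const_of_deriv_eq_zero hf hcon b 0)
  -- Only finitely many critical points lie in the disc, and the nonconstant `f` avoids each of
  -- their values on a punctured neighbourhood of `w`.
  have hfin : ∀ p ∈ zerosIn hd ha R, ∀ᶠ z in 𝓝[≠] w, f z ≠ f p := by
    intro p _
    rcases (hf.analyticAt w).eventually_eq_or_eventually_ne (analyticAt_const (v := f p))
      with h | h
    · obtain ⟨b, hb⟩ := hnc (f p)
      exact absurd (analyticOrderAt_eq_top.2 (h.mono fun z hz => sub_eq_zero.2 hz))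
        (analyticOrderAt_ne_top_of_entire (hf.sub_const (f p)) (sub_ne_zero.2 hb) w)
    · exact h
  filter_upwards [(Finset.eventually_all _).2 hfin] with z hz u hu huR h0
  exact hz u ((mem_zerosIn hd ha).2 ⟨h0, huR.le⟩) hu.symm

/-- Near a point at which all the branches in a disc are holomorphic, the sum over the fibre is
the sum of the branches. -/
lemma exists_eventually_autSum_eq_sum {f : ℂ → ℂ} (hf : Differentiable ℂ f) {R m : ℝ} (hR : 0 < R)
    (hfm : ∀ v, ‖v‖ = R → m ≤ ‖f v‖) {w : ℂ} (hw : ‖f w‖ < m)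
    (hunb : ∀ u, f u = f w → ‖u‖ < R → IsUnbranchedAt f w u) :
    ∃ (S : Finset (Germ (𝓝 w) ℂ)) (g : Germ (𝓝 w) ℂ → ℂ → ℂ),
      (S : Set (Germ (𝓝 w) ℂ)) = {φ ∈ autBranches f w | ‖φ.value‖ < R} ∧
      (∀ φ ∈ S, AnalyticAt ℂ (g φ) w ∧ φ = (g φ : Germ (𝓝 w) ℂ)) ∧
      ∀ᶠ z in 𝓝 w, autSum f R z = ∑ φ ∈ S, g φ z := by
  classical
  have hlt : ∀ z, ‖f z‖ < m → ∀ v, ‖v‖ = R → ‖f z‖ < ‖f v‖ :=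
    fun z hz v hv => hz.trans_le (hfm v hv)
  have hne : ∀ z, ‖f z‖ < m → ∀ v, ‖v‖ = R → f v ≠ f z := fun z hz v hv h =>
    (hlt z hz v hv).ne (by rw [h])
  have hR' : ‖(R : ℂ)‖ = R := by simp [hR.le]
  have ha : ∀ z, ‖f z‖ < m → f R - f z ≠ 0 := fun z hz => sub_ne_zero.2 (hne z hz _ hR')
  set ord : ℂ → ℂ → ℕ := fun z u => analyticOrderNatAt (fun v => f v - f z) u with hord
  set B : ℂ → Set (Germ (𝓝 w) ℂ) := fun u => {φ ∈ autBranches f w | φ.value = u} with hB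
  set Z := zerosIn (hf.sub_const (f w)) (ha w hw) R with hZ
  have hmemZ : ∀ u, u ∈ Z ↔ f u = f w ∧ ‖u‖ < R := by
    intro u
    rw [← Finset.mem_coe, hZ, ← fibre_eq_zerosIn hf (hne w hw) (ha w hw)]
    rfl
  have hBcard : ∀ u ∈ Z, (B u).encard = (ord w u : ℕ∞) := by
    intro u hu
    have h1 := hunb u ((hmemZ u).1 hu).1 ((hmemZ u).1 hu).2
    rw [IsUnbranchedAt, fibreMult] at h1
    rw [hB, h1]
    exact (Nat.cast_analyticOrderNatAt
      (analyticOrderAt_ne_top_of_entire (hf.sub_const (f w)) (ha w hw) u)).symm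
  have hBfin : ∀ u ∈ Z, (B u).Finite := fun u hu =>
    Set.finite_of_encard_eq_coe (hBcard u hu)
  -- Finiteness matters: the `finsum` in `autDerivSum` takes the default value `0` when its support
  -- is infinite.
  have hSfin : {φ ∈ autBranches f w | ‖φ.value‖ < R}.Finite := by
    refine (Z.finite_toSet.biUnion hBfin).subset fun φ hφ => ?_
    exact Set.mem_biUnion (Finset.mem_coe.2 ((hmemZ _).2
      ⟨apply_value_of_mem_autBranches hφ.1, hφ.2⟩)) ⟨hφ.1, rfl⟩
  set S := hSfin.toFinset with hS
  have hmemS : ∀ φ, φ ∈ S ↔ φ ∈ autBranches f w ∧ ‖φ.value‖ < R := fun φ => by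
    rw [hS, Set.Finite.mem_toFinset]; rfl
  have hmaps : ∀ φ ∈ S, φ.value ∈ Z := fun φ hφ =>
    (hmemZ _).2 ⟨apply_value_of_mem_autBranches ((hmemS φ).1 hφ).1, ((hmemS φ).1 hφ).2⟩
  have hfib : ∀ u ∈ Z, (S.filter fun φ => φ.value = u).card = ord w u := by
    intro u hu
    have h1 : ((S.filter fun φ => φ.value = u : Finset _) : Set (Germ (𝓝 w) ℂ)) = B u := by
      ext φ
      rw [Finset.mem_coe, Finset.mem_filter, hmemS]
      refine ⟨fun h => ⟨h.1.1, h.2⟩, fun h => ⟨⟨h.1, ?_⟩, h.2⟩⟩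
      rw [h.2]; exact ((hmemZ u).1 hu).2
    have h2 := hBcard u hu
    rw [← h1, Set.encard_coe_eq_coe_finsetCard] at h2
    exact_mod_cast h2
  have hScard : S.card = ∑ u ∈ Z, ord w u := by
    rw [Finset.card_eq_sum_card_fiberwise (f := fun φ : Germ (𝓝 w) ℂ => φ.value) (t := Z) hmaps]
    exact Finset.sum_congr rfl hfib
  have hbr : ∀ φ ∈ S, ∃ g : ℂ → ℂ, AnalyticAt ℂ g w ∧ (∀ᶠ z in 𝓝 w, f (g z) = f z) ∧
      φ = (g : Germ (𝓝 w) ℂ) := fun φ hφ => ((hmemS φ).1 hφ).1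
  choose! g hg hfg hφg using hbr
  have hval : ∀ φ ∈ S, g φ w = φ.value := fun φ hφ => by
    conv_rhs => rw [hφg φ hφ]
    rfl
  refine ⟨S, g, by rw [hS, Set.Finite.coe_toFinset], fun φ hφ => ⟨hg φ hφ, hφg φ hφ⟩, ?_⟩
  have hself : autSum f R w = ∑ φ ∈ S, g φ w := by
    rw [autSum_eq_fibreSum, fibreSum_eq_sum hf _ (hne w hw) (ha w hw), Finset.sum_congr rfl hval,
      ← Finset.sum_fiberwise_of_maps_to hmaps]
    refine Finset.sum_congr rfl fun u hu => ?_
    rw [Finset.sum_congr rfl (g := fun _ => u) fun φ hφ => (Finset.mem_filter.1 hφ).2,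
      Finset.sum_const, hfib u hu, nsmul_eq_mul]
  have e1 : ∀ᶠ z in 𝓝 w, ∀ φ ∈ S, f (g φ z) = f z ∧ ‖g φ z‖ < R := by
    refine (Finset.eventually_all _).2 fun φ hφ => (hfg φ hφ).and ?_
    refine (hg φ hφ).continuousAt.norm.eventually_lt_const ?_
    simp only [hval φ hφ]
    exact ((hmemS φ).1 hφ).2
  -- By the identity theorem, distinct germs have distinct values at all nearby points other than
  -- `w`.
  have e2 : ∀ᶠ z in 𝓝[≠] w, ∀ φ ∈ S, ∀ ψ ∈ S, φ ≠ ψ → g φ z ≠ g ψ z := by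
    refine (Finset.eventually_all _).2 fun φ hφ => (Finset.eventually_all _).2 fun ψ hψ => ?_
    rcases (hg φ hφ).eventually_eq_or_eventually_ne (hg ψ hψ) with h | h
    · refine Eventually.of_forall fun z hne => absurd ?_ hne
      rw [hφg φ hφ, hφg ψ hψ]
      exact Germ.coe_eq.2 h
    · exact h.mono fun z hz _ => hz
  have e3 : ∀ᶠ z in 𝓝 w, ‖f z‖ < m := (hf w).continuousAt.norm.eventually_lt_const hw
  have hpunct : ∀ᶠ z in 𝓝[≠] w, autSum f R z = ∑ φ ∈ S, g φ z := by
    filter_upwards [e1.filter_mono nhdsWithin_le_nhds, e2, e3.filter_mono nhdsWithin_le_nhds]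
      with z h1 h2 h3
    set Z' := zerosIn (hf.sub_const (f z)) (ha z h3) R with hZ'
    have hmemZ' : ∀ u, u ∈ Z' ↔ f u = f z ∧ ‖u‖ < R := by
      intro u
      rw [← Finset.mem_coe, hZ', ← fibre_eq_zerosIn hf (hne z h3) (ha z h3)]
      rfl
    -- The number of solutions in the disc is the same over `f w` and `f z`, since both are compared
    -- with the value `0`.
    have hcount : ∑ u ∈ Z, ord w u = ∑ u ∈ Z', ord z u := by
      have h4 := (fibreSum_one_eq hf hR (hlt w hw)).trans (fibreSum_one_eq hf hR (hlt z h3)).symm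
      rw [fibreSum_eq_sum hf _ (hne w hw) (ha w hw), fibreSum_eq_sum hf _ (hne z h3) (ha z h3)] at h4
      simp only [mul_one] at h4
      exact_mod_cast h4
    have hinj : Set.InjOn (fun φ => g φ z) S := fun φ hφ ψ hψ h => by
      by_contra hcon
      exact h2 φ hφ ψ hψ hcon h
    have hTcard : (S.image fun φ => g φ z).card = S.card := Finset.card_image_of_injOn hinj
    have hTsub : (S.image fun φ => g φ z) ⊆ Z' := by
      intro u hu
      obtain ⟨φ, hφ, rfl⟩ := Finset.mem_image.1 hu
      exact (hmemZ' _).2 (h1 φ hφ)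
    have hpos : ∀ u ∈ Z', 1 ≤ ord z u := by
      intro u hu
      rw [Nat.one_le_iff_ne_zero]
      intro h0
      have h5 := Nat.cast_analyticOrderNatAt
        (analyticOrderAt_ne_top_of_entire (hf.sub_const (f z)) (ha z h3) u)
      rw [show analyticOrderNatAt (fun v => f v - f z) u = 0 from h0, Nat.cast_zero] at h5
      exact ((hf.sub_const (f z)).analyticAt u).analyticOrderAt_eq_zero.1 h5.symm
        (sub_eq_zero.2 ((hmemZ' u).1 hu).1)
    have hle : Z'.card ≤ ∑ u ∈ Z', ord z u := by
      rw [Finset.card_eq_sum_ones]; exact Finset.sum_le_sum hpos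
    have hle2 := Finset.card_le_card hTsub
    -- The branches give `S.card` distinct solutions, and this is already the total count with
    -- multiplicity. So they fill the fibre, and every solution in it is simple.
    have hTeq : (S.image fun φ => g φ z) = Z' :=
      Finset.eq_of_subset_of_card_le hTsub (by omega)
    have hone : ∀ u ∈ Z', 1 = ord z u := by
      refine (Finset.sum_eq_sum_iff_of_le hpos).1 ?_
      rw [← Finset.card_eq_sum_ones]
      omega
    rw [autSum_eq_fibreSum, fibreSum_eq_sum hf _ (hne z h3) (ha z h3),
      ← Finset.sum_image (f := fun u => u) hinj, hTeq]
    refine Finset.sum_congr rfl fun u hu => ?_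
    have : analyticOrderNatAt (fun v => f v - f z) u = 1 := (hone u hu).symm
    rw [this, Nat.cast_one, one_mul]
  rw [eventually_nhdsWithin_iff] at hpunct
  filter_upwards [hpunct] with z hz
  rcases eq_or_ne z w with rfl | hzw
  · exact hself
  · exact hz hzw

lemma autDerivSum_eq_iteratedDeriv_autSum {f : ℂ → ℂ} (hf : Differentiable ℂ f) {R m : ℝ}
    (hR : 0 < R) (hfm : ∀ v, ‖v‖ = R → m ≤ ‖f v‖) {w : ℂ} (hw : ‖f w‖ < m)
    (hunb : ∀ u, f u = f w → ‖u‖ < R → IsUnbranchedAt f w u) (k : ℕ) :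
    autDerivSum f k R w = iteratedDeriv k (autSum f R) w := by
  obtain ⟨S, g, hS, hg, hsum⟩ := exists_eventually_autSum_eq_sum hf hR hfm hw hunb
  rw [EventuallyEq.iteratedDeriv_eq k hsum,
    iteratedDeriv_fun_sum fun φ hφ => (hg φ hφ).1.contDiffAt, autDerivSum, ← hS,
    finsum_mem_coe_finset]
  refine Finset.sum_congr rfl fun φ hφ => ?_
  conv_lhs => rw [(hg φ hφ).2]
  rfl

/-! ### Choice of the radii and passage to the limit -/

/-- Circles tending to infinity on which `f` is much larger than the radius. -/
lemma exists_radii {f : ℂ → ℂ} (hf : Differentiable ℂ f) {ρ : ℝ} (hρ0 : 0 < ρ)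
    (hρ1 : ρ < 1 / 2) (hord : growthOrder f = (ρ : EReal)) :
    ∃ R : ℕ → ℝ, (∀ j, 0 < R j) ∧ StrictMono R ∧ Tendsto R atTop atTop ∧
      ∀ j v, ‖v‖ = R j → (j + 1) * R j ≤ ‖f v‖ := by
  choose s hs hsv using exists_circle_large_minimum hf hρ0 hρ1 hord
  -- Each radius exceeds the previous one by at least `1`. The slope is `1` at index `0` and `n + 2`
  -- at index `n + 1`, that is, `j + 1` at every index `j`.
  let R : ℕ → ℝ := fun j => Nat.rec (s 1 1) (fun n r => s (n + 2) (r + 1)) j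
  have hstep : ∀ j, R j + 1 ≤ R (j + 1) := fun j => hs _ _
  have hlow : ∀ j : ℕ, (j + 1 : ℝ) ≤ R j := by
    intro j
    induction j with
    | zero =>
      have h1 : 1 ≤ R 0 := hs 1 1
      simpa using h1
    | succ j ih =>
      push_cast
      linarith [hstep j]
  refine ⟨R, fun j => lt_of_lt_of_le (by positivity) (hlow j),
    strictMono_nat_of_lt_succ fun j => by linarith [hstep j],
    tendsto_atTop_mono (fun j => (le_add_of_nonneg_right zero_le_one).trans (hlow j))
      tendsto_natCast_atTop_atTop, fun j v hv => ?_⟩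
  cases j with
  | zero =>
    have h1 : 1 * R 0 ≤ ‖f v‖ := (hsv 1 1 v hv).le
    simpa using h1
  | succ j =>
    have := (hsv (j + 2) (R j + 1) v hv).le
    push_cast
    rw [show (j : ℝ) + 1 + 1 = j + 2 by ring]
    exact this

/-- The orbit sum is `fibreSum` composed with `f`, so it is holomorphic at `w` even if single
branches ramify there. -/
lemma analyticAt_autSum {f : ℂ → ℂ} (hf : Differentiable ℂ f) {R m : ℝ}
    (hR : 0 < R) (hfm : ∀ v, ‖v‖ = R → m ≤ ‖f v‖) {w : ℂ} (hw : ‖f w‖ < m) :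
    AnalyticAt ℂ (autSum f R) w := by
  have h1 : AnalyticAt ℂ (fibreSum f (fun v => v) R) (f w) :=
    (differentiableOn_fibreSum hf differentiable_fun_id hR hfm).analyticAt
      (Metric.isOpen_ball.mem_nhds (by simpa using hw))
  exact h1.comp (hf.analyticAt w)

/-- Cauchy's estimate for the derivatives of the sum over the fibre. -/
lemma norm_iteratedDeriv_autSum_le {f : ℂ → ℂ} (hf : Differentiable ℂ f) {R m C : ℝ} (hR : 0 < R)
    (hm : 0 < m) (hfm : ∀ v, ‖v‖ = R → m ≤ ‖f v‖) (hC : 2 * C ≤ m) {w : ℂ}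
    (hw : ∀ z ∈ Metric.closedBall w 1, ‖f z‖ ≤ C) {k : ℕ} (hk : 1 ≤ k) :
    ‖iteratedDeriv k (autSum f R) w‖ ≤ k.factorial * (R * (3 / 2 * (C / m))) := by
  have hlt : ∀ z ∈ Metric.closedBall w 1, ‖f z‖ < m := fun z hz => by
    linarith [hw z hz, norm_nonneg (f z)]
  -- Only the difference from the sum over the fibre of `0` is known to be small; the subtracted
  -- constant disappears on differentiating, as `1 ≤ k`.
  have hd : DiffContOnCl ℂ (fun z => -fibreSum f (fun v => v) R 0 + autSum f R z)
      (Metric.ball w 1) := by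
    refine DifferentiableOn.diffContOnCl fun z hz => ?_
    have hz' := Metric.closure_ball_subset_closedBall hz
    exact ((analyticAt_autSum hf hR hfm
      (hlt z hz')).differentiableAt.const_add _).differentiableWithinAt
  have key := Complex.norm_iteratedDeriv_le_of_forall_mem_sphere_norm_le k one_pos hd
    (C := R * (3 / 2 * (C / m))) fun z hz => by
      have hz' := hw z (Metric.sphere_subset_closedBall hz)
      rw [neg_add_eq_sub, autSum_eq_fibreSum]
      exact (norm_fibreSum_sub_le hf hR hm hfm (by linarith)).trans (by gcongr)
  rwa [iteratedDeriv_const_add (by omega), one_pow, div_one] at key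

theorem theorem15 (f : ℂ → ℂ) (hf : Differentiable ℂ f) (ρ : ℝ) (hρ0 : 0 < ρ) (hρ1 : ρ < 1 / 2)
    (hord : growthOrder f = (ρ : EReal)) :
    ∃ R : ℕ → ℝ, (∀ j, 0 < R j) ∧ StrictMono R ∧ Tendsto R atTop atTop ∧
      ∀ k : ℕ, 1 ≤ k → ∀ w : ℂ,
        -- the sums of the derivatives tend to zero wherever all the branches are holomorphic
        ((∀ u, f u = f w → IsUnbranchedAt f w u) →
          Tendsto (fun j => autDerivSum f k (R j) w) atTop (𝓝 0)) ∧
        -- at every point, the derivatives of the sums exist and tend to zero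
        (∀ᶠ j in atTop, AnalyticAt ℂ (autSum f (R j)) w) ∧
        Tendsto (fun j => iteratedDeriv k (autSum f (R j)) w) atTop (𝓝 0) ∧
        -- the two agree near every point, except possibly at the point itself, so that the
        -- derivative of the sum is the continuous extension of the sum of the derivatives
        (∀ᶠ j in atTop, ∀ᶠ z in 𝓝[≠] w,
          (∀ u, f u = f z → ‖u‖ < R j → IsUnbranchedAt f z u) ∧
          autDerivSum f k (R j) z = iteratedDeriv k (autSum f (R j)) z) := by
  have hnc : ∀ c, ∃ a, f a ≠ c := by
    intro c
    by_contra hcon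
    push Not at hcon
    refine not_linear_growth hf hρ0 hord ‖c‖ fun z => ?_
    rw [hcon z]
    exact le_mul_of_one_le_right (norm_nonneg _) (by linarith [norm_nonneg z])
  obtain ⟨R, hR, hmono, hlim, hRf⟩ := exists_radii hf hρ0 hρ1 hord
  refine ⟨R, hR, hmono, hlim, fun k hk w => ?_⟩
  have hmlim : Tendsto (fun j : ℕ => ((j : ℝ) + 1) * R j) atTop atTop :=
    (tendsto_atTop_add_const_right _ 1 tendsto_natCast_atTop_atTop).atTop_mul_atTop₀ hlim
  have hlarge : ∀ᶠ j : ℕ in atTop, ‖f w‖ < ((j : ℝ) + 1) * R j := hmlim.eventually_gt_atTop _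
  have htend : Tendsto (fun j => iteratedDeriv k (autSum f (R j)) w) atTop (𝓝 0) := by
    obtain ⟨C, hC⟩ := (isCompact_closedBall w 1).exists_bound_of_continuousOn
      hf.continuous.continuousOn
    -- With `m = (j + 1) * R j` the factor `R j` in the estimate cancels, leaving `1 / (j + 1)`.
    refine squeeze_zero_norm' (a := fun j : ℕ => k.factorial * (3 / 2 * C) * (1 / ((j : ℝ) + 1)))
      ?_ ?_
    · filter_upwards [hmlim.eventually_ge_atTop (2 * C)] with j hj
      have hRj := hR j
      refine (norm_iteratedDeriv_autSum_le hf hRj (by positivity) (hRf j) hj hC hk).trans_eq ?_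
      field_simp
    · simpa using tendsto_one_div_add_atTop_nhds_zero_nat.const_mul
        ((k.factorial : ℝ) * (3 / 2 * C))
  refine ⟨fun hunb => htend.congr' ?_, ?_, htend, ?_⟩
  · filter_upwards [hlarge] with j hj
    exact (autDerivSum_eq_iteratedDeriv_autSum hf (hR j) (hRf j) hj
      (fun u hu _ => hunb u hu) k).symm
  · filter_upwards [hlarge] with j hj
    exact analyticAt_autSum hf (hR j) (hRf j) hj
  · filter_upwards [hlarge] with j hj
    have h1 : ∀ᶠ z in 𝓝 w, ‖f z‖ < ((j : ℝ) + 1) * R j :=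
      (hf w).continuousAt.norm.eventually_lt_const hj
    filter_upwards [h1.filter_mono nhdsWithin_le_nhds, eventually_deriv_ne_zero hf hnc (R j) w]
      with z hz hd
    have hunb : ∀ u, f u = f z → ‖u‖ < R j → IsUnbranchedAt f z u := fun u hu huR =>
      isUnbranchedAt_of_deriv_ne_zero hf hu (hd u hu huR)
    exact ⟨hunb, autDerivSum_eq_iteratedDeriv_autSum hf (hR j) (hRf j) hz hunb k⟩
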